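/- Let $d,m\in\mathbb N_0$, let $A$ be a real $d\times d$ matrix, $\delta\in\mathbb R$, $\theta$ a probability measure on $\mathbb R^m$, and let $f:\mathbb R^d\times\mathcal P(\mathbb R^d)\times\mathbb R^m\to\mathbb R^d$ be measurable, where $\mathcal P(\mathbb R^d)$ (the probability measures on $\mathbb R^d$) carries the Borel $\sigma$-field of the topology of weak convergence. Let $\mathcal P_1(\mathbb R^d)$ be the set of $\mu\in\mathcal P(\mathbb R^d)$ with $\int|x|\,\mu(dx)<\infty$, let $\mathcal W_1$ be the Wasserstein-1 distance, $\mathcal W_1(\mu,\nu)=\inf E|X-Y|$ over all couplings of $X\sim\mu$ and $Y\sim\nu$, and let $\mu_0\in\mathcal P_1(\mathbb R^d)$. For each $N\ge1$ let $(X_n^{i})_{1\le i\le N,\,n\ge0}=(X_n^{i,N})$ satisfy $$X_{n+1}^{i}=AX_n^{i}+\delta f(X_n^{i},\mu_n^N,\epsilon_{n+1}^{i}),\qquad \mu_n^N=\frac1N\sum_{j=1}^N\delta_{X_n^{j}},$$ where $X_0^{1},\dots,X_0^{N}$ are exchangeable with common law $\mu_0$ and $(\epsilon_n^{i})_{1\le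 i\le N,\,n\ge1}$ are i.i.d. with law $\theta$ and independent of $(X_0^1,\dots,X_0^N)$. Let $(X_n)_{n\ge0}$ be the nonlinear Markov chain $$X_{n+1}=AX_n+\delta f(X_n,\mu_n,\epsilon_{n+1}),\qquad \mathcal L(X_n)=\mu_n,\quad n\ge0,$$ where $(\epsilon_n)_{n\ge1}$ are i.i.d. with law $\theta$ and independent of $X_0$. Assume (A) $\int D(z)\,\theta(dz)<\infty$, where $D(z)=\sup\frac{|f(x_1,\mu_1,z)-f(x_2,\mu_2,z)|}{|x_1-x_2|+\mathcal W_1(\mu_1,\mu_2)}$, the supremum being over $x_1\ne x_2$ in $\mathbb R^d$ and $\mu_1\neq\mu_2$ in $\mathcal P_1(\mathbb R^d)$; (B) $\int|f(0,\delta_0,z)|\,\theta(dz)<\infty$; and that $E\,\mathcal W_1(\mu_0^N,\mu_0)\to0$ as $N\to\infty$. Then for every $k\ge1$ and every $n\ge0$, the joint law $\mathcal L(X_n^{1},\dots,X_n^{k})$ converges weakly to $\mathcal L(X_n)^{\otimes k}$ as $N\to\infty$. -/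

import Mathlib

open MeasureTheory ProbabilityTheory Filter Topology
open scoped ENNReal

noncomputable section

/-- Membership of a probability law on a normed space in `𝒫₁`: finite first moment. -/
def HasFiniteFirstMoment {E : Type*} [NormedAddCommGroup E] [MeasurableSpace E]
    (μ : ProbabilityMeasure E) : Prop :=
  ∫⁻ x, ‖x‖ₑ ∂(μ : Measure E) < ∞

/-- The Wasserstein-1 distance, as the infimum of `E|X - Y|` over all joint laws of pairs `(X, Y)`
with marginals `μ` and `ν`. -/
def W1 {E : Type*} [NormedAddCommGroup E] [MeasurableSpace E]
    (μ ν : ProbabilityMeasure E) : ℝ≥0∞ :=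
  ⨅ (γ : Measure (E × E)) (_ : γ.map Prod.fst = (μ : Measure E) ∧
      γ.map Prod.snd = (ν : Measure E)), ∫⁻ p, ‖p.1 - p.2‖ₑ ∂γ

/-- The empirical measure `(1/N) ∑ᵢ δ_{xᵢ}` of `N ≥ 1` points. -/
def empiricalMeasure {E : Type*} [MeasurableSpace E] {N : ℕ} [NeZero N] (x : Fin N → E) :
    ProbabilityMeasure E :=
  ⟨(N : ℝ≥0∞)⁻¹ • ∑ i, Measure.dirac (x i), ⟨by
    simp [ENNReal.inv_mul_cancel (Nat.cast_ne_zero.mpr (NeZero.ne N))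
      (ENNReal.natCast_ne_top N)]⟩⟩

/-- A finite family of random variables is exchangeable: its joint law is invariant under
permutations of the indices. -/
def Exchangeable {Ω E : Type*} [MeasurableSpace Ω] [MeasurableSpace E] {N : ℕ}
    (Y : Fin N → Ω → E) (P : Measure Ω) : Prop :=
  ∀ π : Equiv.Perm (Fin N), P.map (fun ω i => Y i ω) = P.map (fun ω i => Y (π i) ω)

/-- The Lipschitz coefficient `D(z)` of `f(·, ·, z)` on `ℝᵈ × 𝒫₁(ℝᵈ)`, valued in `[0, ∞]`. -/
def lipCoeff {d m : ℕ}
    (f : EuclideanSpace ℝ (Fin d) × ProbabilityMeasure (EuclideanSpace ℝ (Fin d)) ×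
      EuclideanSpace ℝ (Fin m) → EuclideanSpace ℝ (Fin d))
    (z : EuclideanSpace ℝ (Fin m)) : ℝ≥0∞ :=
  ⨆ (x₁ : EuclideanSpace ℝ (Fin d)) (x₂ : EuclideanSpace ℝ (Fin d))
    (μ₁ : ProbabilityMeasure (EuclideanSpace ℝ (Fin d)))
    (μ₂ : ProbabilityMeasure (EuclideanSpace ℝ (Fin d)))
    (_ : x₁ ≠ x₂ ∧ μ₁ ≠ μ₂ ∧ HasFiniteFirstMoment μ₁ ∧ HasFiniteFirstMoment μ₂),
    ‖f (x₁, μ₁, z) - f (x₂, μ₂, z)‖ₑ / (‖x₁ - x₂‖ₑ + W1 μ₁ μ₂)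

/-- `D` is `θ`-integrable. (The almost everywhere measurability only says that the integral of the
uncountable supremum `D` makes sense.) -/
def AssumptionA {d m : ℕ}
    (f : EuclideanSpace ℝ (Fin d) × ProbabilityMeasure (EuclideanSpace ℝ (Fin d)) ×
      EuclideanSpace ℝ (Fin m) → EuclideanSpace ℝ (Fin d))
    (θ : ProbabilityMeasure (EuclideanSpace ℝ (Fin m))) : Prop :=
  AEMeasurable (lipCoeff f) (θ : Measure (EuclideanSpace ℝ (Fin m))) ∧
    ∫⁻ z, lipCoeff f z ∂(θ : Measure (EuclideanSpace ℝ (Fin m))) < ∞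

/-- `D₁(z) = |f(0, δ₀, z)|` is `θ`-integrable. -/
def AssumptionB {d m : ℕ}
    (f : EuclideanSpace ℝ (Fin d) × ProbabilityMeasure (EuclideanSpace ℝ (Fin d)) ×
      EuclideanSpace ℝ (Fin m) → EuclideanSpace ℝ (Fin d))
    (θ : ProbabilityMeasure (EuclideanSpace ℝ (Fin m))) : Prop :=
  ∫⁻ z, ‖f (0, diracProba 0, z)‖ₑ ∂(θ : Measure (EuclideanSpace ℝ (Fin m))) < ∞

/-- The `N`-particle system
`X^i_{n+1} = A X^i_n + δ f(X^i_n, μ^N_n, ε^i_{n+1})`, `μ^N_n = (1/N) ∑ᵢ δ_{X^i_n}`, where the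
`X^i_0` are exchangeable with common law `μ₀` and the noise is i.i.d. with law `θ` and independent
of the initial state. Here `ε i n` stands for the noise `ε^i_{n+1}` driving the step from
time `n` to time `n + 1`. -/
structure IsParticleSystem {d m : ℕ} (A : Matrix (Fin d) (Fin d) ℝ) (δ : ℝ)
    (f : EuclideanSpace ℝ (Fin d) × ProbabilityMeasure (EuclideanSpace ℝ (Fin d)) ×
      EuclideanSpace ℝ (Fin m) → EuclideanSpace ℝ (Fin d))
    (θ : ProbabilityMeasure (EuclideanSpace ℝ (Fin m)))
    (μ₀ : ProbabilityMeasure (EuclideanSpace ℝ (Fin d)))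
    {N : ℕ} [NeZero N] {Ω : Type*} [MeasurableSpace Ω] (P : Measure Ω)
    (X : Fin N → ℕ → Ω → EuclideanSpace ℝ (Fin d))
    (ε : Fin N → ℕ → Ω → EuclideanSpace ℝ (Fin m)) : Prop where
  measurable_state : ∀ i n, Measurable (X i n)
  measurable_noise : ∀ i n, Measurable (ε i n)
  exchangeable_init : Exchangeable (fun i => X i 0) P
  law_init : ∀ i, P.map (X i 0) = (μ₀ : Measure (EuclideanSpace ℝ (Fin d)))
  law_noise : ∀ i n, P.map (ε i n) = (θ : Measure (EuclideanSpace ℝ (Fin m)))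
  indep_noise : iIndepFun (fun p : Fin N × ℕ => ε p.1 p.2) P
  indep_init_noise :
    IndepFun (fun ω i => X i 0 ω) (fun ω (p : Fin N × ℕ) => ε p.1 p.2 ω) P
  step : ∀ i n, ∀ᵐ ω ∂P, X i (n + 1) ω =
    Matrix.toEuclideanLin A (X i n ω) +
      δ • f (X i n ω, empiricalMeasure (fun j => X j n ω), ε i n ω)

/-- The nonlinear Markov chain `X_{n+1} = A X_n + δ f(X_n, μ_n, ε_{n+1})`, `ℒ(X_n) = μ_n`, with
i.i.d. noise of law `θ` independent of `X_0`. Here `η n` stands for the noise `ε_{n+1}`. -/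
structure IsNonlinearChain {d m : ℕ} (A : Matrix (Fin d) (Fin d) ℝ) (δ : ℝ)
    (f : EuclideanSpace ℝ (Fin d) × ProbabilityMeasure (EuclideanSpace ℝ (Fin d)) ×
      EuclideanSpace ℝ (Fin m) → EuclideanSpace ℝ (Fin d))
    (θ : ProbabilityMeasure (EuclideanSpace ℝ (Fin m)))
    (μ : ℕ → ProbabilityMeasure (EuclideanSpace ℝ (Fin d)))
    {Ω : Type*} [MeasurableSpace Ω] (Q : Measure Ω)
    (Y : ℕ → Ω → EuclideanSpace ℝ (Fin d))
    (η : ℕ → Ω → EuclideanSpace ℝ (Fin m)) : Prop where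
  measurable_state : ∀ n, Measurable (Y n)
  measurable_noise : ∀ n, Measurable (η n)
  law_state : ∀ n, Q.map (Y n) = (μ n : Measure (EuclideanSpace ℝ (Fin d)))
  law_noise : ∀ n, Q.map (η n) = (θ : Measure (EuclideanSpace ℝ (Fin m)))
  indep_noise : iIndepFun η Q
  indep_init_noise : IndepFun (Y 0) (fun ω n => η n ω) Q
  step : ∀ n, ∀ᵐ ω ∂Q, Y (n + 1) ω =
    Matrix.toEuclideanLin A (Y n ω) + δ • f (Y n ω, μ n, η n ω)

end

/-! Write μ^N_n for the empirical measure of the particles. The property carried through time is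
that μ^N_n converges to μ_n in mean when tested against each Lipschitz function
(`EmpiricalTendsto`). At time 0 it follows from the hypothesis on W₁, since a K-Lipschitz test
separates two laws by at most K times their W₁-distance.

For the step from n to n + 1, freeze the measure argument at μ_n, giving the random map G(x, z) = Ax
+ δ f(x, μ_n, z). Given the states, the images G(X^i_n, ε^i) are independent, so for a test φ
clamped at level R their average is within R/√N, in mean, of its conditional expectation. Clamping
costs the excess (|φ| - R)⁺, which is again Lipschitz. The conditional expectation is the average of
the transition operator applied to φ, a Lipschitz function because D is integrable, so the induction
hypothesis identifies the limit (`EmpiricalTendsto.image`).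

Unfreezing the measure costs at most |δ| D(ε^i) W₁(μ^N_n, μ_n). The noise is independent of the
states, so the mean of this product splits (`EmpiricalTendsto.step`). It is small because, up to any
r > 0, the W₁-distance to a fixed law of finite first moment is bounded by finitely many Lipschitz
tests (`exists_lipschitz_test_family`): a Lipschitz partition of unity moves both laws to finitely
many nodes, where the weights are coupled by hand.

The dynamics commute with permutations, so exchangeability persists. For exchangeable particles, the
mean of Φ(X^1, …, X^k) equals that of the integral of Φ against the k-th power of the empirical
measure, up to an error proportional to the probability that k uniform indices repeat. For Lipschitz
Φ that integral is W₁-Lipschitz in the measure, which gives the limit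
(`EmpiricalTendsto.tendstoInDistribution`).

The coefficient D only compares pairs that differ in both arguments; `enorm_sub_le_lipCoeff_mul`
removes this restriction by small translations. -/

theorem map_fst_snd_prod {E : Type*} [MeasurableSpace E] (μ ν : ProbabilityMeasure E) :
    ((μ : Measure E).prod (ν : Measure E)).map Prod.fst = (μ : Measure E) ∧
      ((μ : Measure E).prod (ν : Measure E)).map Prod.snd = (ν : Measure E) := by
  simp [Measure.map_fst_prod, Measure.map_snd_prod]

/-! ### Couplings, first moments and translations. -/

section Wasserstein

variable {E : Type*} [NormedAddCommGroup E] [MeasurableSpace E]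

theorem W1_le_of_coupling {μ ν : ProbabilityMeasure E} (γ : Measure (E × E))
    (h₁ : γ.map Prod.fst = (μ : Measure E)) (h₂ : γ.map Prod.snd = (ν : Measure E)) :
    W1 μ ν ≤ ∫⁻ p, ‖p.1 - p.2‖ₑ ∂γ :=
  iInf₂_le γ ⟨h₁, h₂⟩

/-- To bound a quantity by a multiple of `W1 μ ν`, it suffices to do so along every coupling. -/
theorem le_mul_W1 {μ ν : ProbabilityMeasure E} {a : ℝ≥0∞} (K : NNReal)
    (h : ∀ γ : Measure (E × E), γ.map Prod.fst = (μ : Measure E) →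
      γ.map Prod.snd = (ν : Measure E) → a ≤ K * ∫⁻ p, ‖p.1 - p.2‖ₑ ∂γ) :
    a ≤ K * W1 μ ν := by
  rcases eq_or_ne K 0 with rfl | hK
  · simpa using h _ (map_fst_snd_prod μ ν).1 (map_fst_snd_prod μ ν).2
  · have hK' : (K : ℝ≥0∞) ≠ 0 := by simpa using hK
    rw [mul_comm, ← ENNReal.div_le_iff hK' ENNReal.coe_ne_top]
    refine le_iInf₂ fun γ hγ => ?_
    rw [ENNReal.div_le_iff hK' ENNReal.coe_ne_top, mul_comm]
    exact h γ hγ.1 hγ.2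

variable [BorelSpace E]

/-- The translate of a probability measure by the vector `v`. -/
noncomputable def translateProba (μ : ProbabilityMeasure E) (v : E) : ProbabilityMeasure E :=
  μ.map (f := fun x => x + v) (by fun_prop)

theorem coe_translateProba (μ : ProbabilityMeasure E) (v : E) :
    (translateProba μ v : Measure E) = (μ : Measure E).map fun x => x + v := rfl

variable [SecondCountableTopology E]

theorem LipschitzWith.integrable_of_hasFiniteFirstMoment {μ : ProbabilityMeasure E}
    (hμ : HasFiniteFirstMoment μ) {F : Type*} [NormedAddCommGroup F] [SecondCountableTopology F]
    {K : NNReal} {φ : E → F} (hφ : LipschitzWith K φ) :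
    Integrable φ (μ : Measure E) := by
  have hid : Integrable (fun x : E => ‖x‖) (μ : Measure E) := by
    refine ⟨by fun_prop, ?_⟩
    simpa [HasFiniteIntegral, HasFiniteFirstMoment] using hμ
  refine ((hid.const_mul K).add (integrable_const ‖φ 0‖)).mono'
    hφ.continuous.aestronglyMeasurable (ae_of_all _ fun x => ?_)
  have := hφ.norm_sub_le x 0
  have h2 := norm_sub_norm_le (φ x) (φ 0)
  simp only [sub_zero] at this
  simp only [Pi.add_apply]
  linarith

/-- The easy half of Kantorovich duality: along any coupling, the difference of the integrals is the
integral of φ(x) - φ(y). -/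
theorem enorm_integral_sub_le_mul_W1 {μ ν : ProbabilityMeasure E}
    (hμ : HasFiniteFirstMoment μ) (hν : HasFiniteFirstMoment ν) {K : NNReal} {φ : E → ℝ}
    (hφ : LipschitzWith K φ) :
    ‖∫ x, φ x ∂(μ : Measure E) - ∫ x, φ x ∂(ν : Measure E)‖ₑ ≤ K * W1 μ ν := by
  refine le_mul_W1 K fun γ h₁ h₂ => ?_
  have i₁ := hφ.integrable_of_hasFiniteFirstMoment hμ
  have i₂ := hφ.integrable_of_hasFiniteFirstMoment hν
  rw [← h₁] at i₁ ⊢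
  rw [← h₂] at i₂ ⊢
  rw [integral_map measurable_fst.aemeasurable i₁.1, integral_map measurable_snd.aemeasurable i₂.1,
    ← integral_sub (f := fun p : E × E => φ p.1) (g := fun p : E × E => φ p.2)
      (i₁.comp_measurable measurable_fst) (i₂.comp_measurable measurable_snd)]
  refine (enorm_integral_le_lintegral_enorm _).trans ?_
  rw [← lintegral_const_mul _ (by fun_prop)]
  refine lintegral_mono fun p => ?_
  have := hφ p.1 p.2
  rwa [edist_eq_enorm_sub, edist_eq_enorm_sub] at this

theorem W1_lt_top {μ ν : ProbabilityMeasure E}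
    (hμ : HasFiniteFirstMoment μ) (hν : HasFiniteFirstMoment ν) : W1 μ ν < ∞ := by
  obtain ⟨h₁, h₂⟩ := map_fst_snd_prod μ ν
  refine (W1_le_of_coupling _ h₁ h₂).trans_lt ?_
  calc ∫⁻ p, ‖p.1 - p.2‖ₑ ∂(μ : Measure E).prod (ν : Measure E)
      ≤ ∫⁻ p, (‖p.1‖ₑ + ‖p.2‖ₑ) ∂(μ : Measure E).prod (ν : Measure E) :=
        lintegral_mono fun p => enorm_sub_le
    _ = ∫⁻ x, ‖x‖ₑ ∂(μ : Measure E) + ∫⁻ x, ‖x‖ₑ ∂(ν : Measure E) := by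
        rw [lintegral_add_left (by fun_prop)]
        congr 1
        · conv_rhs => rw [← h₁, lintegral_map (by fun_prop) measurable_fst]
        · conv_rhs => rw [← h₂, lintegral_map (by fun_prop) measurable_snd]
    _ < ∞ := ENNReal.add_lt_top.2 ⟨hμ, hν⟩

theorem hasFiniteFirstMoment_diracProba (x : E) : HasFiniteFirstMoment (diracProba x) := by
  simp [HasFiniteFirstMoment, diracProba]

theorem HasFiniteFirstMoment.translate {μ : ProbabilityMeasure E} (hμ : HasFiniteFirstMoment μ)
    (v : E) : HasFiniteFirstMoment (translateProba μ v) := by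
  unfold HasFiniteFirstMoment
  rw [coe_translateProba, lintegral_map (by fun_prop) (by fun_prop)]
  refine (lintegral_mono fun x => enorm_add_le x v).trans_lt ?_
  rw [lintegral_add_right _ measurable_const]
  simpa [HasFiniteFirstMoment] using hμ

theorem W1_translate_le (μ ν : ProbabilityMeasure E) (v : E) :
    W1 (translateProba μ v) ν ≤ W1 μ ν + ‖v‖ₑ := by
  unfold W1
  rw [ENNReal.iInf_add]
  refine le_iInf fun γ => ?_
  rw [ENNReal.iInf_add]
  refine le_iInf fun hγ => ?_
  have : IsProbabilityMeasure γ := by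
    refine ⟨?_⟩
    have h := congrArg (fun m : Measure E => m Set.univ) hγ.1
    simpa [Measure.map_apply measurable_fst] using h
  refine (W1_le_of_coupling (μ := translateProba μ v) (ν := ν)
    (γ.map fun p => (p.1 + v, p.2)) ?_ ?_).trans ?_
  · rw [Measure.map_map measurable_fst (by fun_prop), coe_translateProba, ← hγ.1,
      Measure.map_map (by fun_prop) measurable_fst]
    rfl
  · rw [Measure.map_map measurable_snd (by fun_prop), ← hγ.2]
    rfl
  · rw [lintegral_map (by fun_prop) (by fun_prop)]
    refine (lintegral_mono (g := fun p => ‖p.1 - p.2‖ₑ + ‖v‖ₑ) fun p => ?_).trans ?_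
    · rw [add_sub_right_comm]
      exact enorm_add_le _ _
    · rw [lintegral_add_right _ measurable_const]
      simp

theorem W1_translate_self_le (μ : ProbabilityMeasure E) (v : E) :
    W1 μ (translateProba μ v) ≤ ‖v‖ₑ := by
  refine (W1_le_of_coupling ((μ : Measure E).map fun x => (x, x + v)) ?_ ?_).trans ?_
  · rw [Measure.map_map measurable_fst (by fun_prop)]
    exact Measure.map_id
  · rw [Measure.map_map measurable_snd (by fun_prop)]
    rfl
  · rw [lintegral_map (by fun_prop) (by fun_prop)]
    simp

/-- Means tell a law from its translates, which is how distinctness of measures is certified when a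
pair is perturbed below. -/
theorem integral_translate [NormedSpace ℝ E] [CompleteSpace E]
    {μ : ProbabilityMeasure E} (hμ : HasFiniteFirstMoment μ) (v : E) :
    ∫ x, x ∂(translateProba μ v : Measure E) = ∫ x, x ∂(μ : Measure E) + v := by
  rw [coe_translateProba, integral_map (by fun_prop) (by fun_prop),
    integral_add (f := fun x => x) (LipschitzWith.id.integrable_of_hasFiniteFirstMoment hμ) (integrable_const v)]
  simp

end Wasserstein

/-! ### Lipschitz estimate from the coefficient D. -/

section LipschitzCoefficient

variable {d m : ℕ}
  {f : EuclideanSpace ℝ (Fin d) × ProbabilityMeasure (EuclideanSpace ℝ (Fin d)) ×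
    EuclideanSpace ℝ (Fin m) → EuclideanSpace ℝ (Fin d)}

theorem enorm_sub_le_lipCoeff_mul_of_ne {x₁ x₂ : EuclideanSpace ℝ (Fin d)}
    {μ₁ μ₂ : ProbabilityMeasure (EuclideanSpace ℝ (Fin d))} (hx : x₁ ≠ x₂) (hμ : μ₁ ≠ μ₂)
    (h₁ : HasFiniteFirstMoment μ₁) (h₂ : HasFiniteFirstMoment μ₂)
    (z : EuclideanSpace ℝ (Fin m)) :
    ‖f (x₁, μ₁, z) - f (x₂, μ₂, z)‖ₑ ≤ lipCoeff f z * (‖x₁ - x₂‖ₑ + W1 μ₁ μ₂) := by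
  have h0 : ‖x₁ - x₂‖ₑ + W1 μ₁ μ₂ ≠ 0 := by
    simp [sub_eq_zero, hx]
  have htop : ‖x₁ - x₂‖ₑ + W1 μ₁ μ₂ ≠ ∞ := by
    simp [(W1_lt_top h₁ h₂).ne]
  rw [← ENNReal.div_le_iff h0 htop]
  unfold lipCoeff
  refine le_trans ?_ (le_iSup _ x₁)
  refine le_trans ?_ (le_iSup _ x₂)
  refine le_trans ?_ (le_iSup _ μ₁)
  refine le_trans ?_ (le_iSup _ μ₂)
  exact le_iSup_of_le ⟨hx, hμ, h₁, h₂⟩ le_rfl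

theorem exists_small_ne {E : Type*} [NormedAddCommGroup E] [NormedSpace ℝ E] [Nontrivial E]
    (s : Finset E) {r : ℝ} (hr : 0 < r) : ∃ v : E, ‖v‖ < r ∧ v ∉ s := by
  have hinf : (Metric.ball (0 : E) r).Infinite :=
    infinite_of_mem_nhds 0 (Metric.ball_mem_nhds 0 hr)
  obtain ⟨v, hv, hvs⟩ := hinf.exists_notMem_finset s
  exact ⟨v, by simpa using hv, hvs⟩

/-- Where finite, `lipCoeff f z` is a Lipschitz constant of `f(·, ·, z)`, also between points
that agree in one of their two coordinates. -/
theorem enorm_sub_le_lipCoeff_mul {z : EuclideanSpace ℝ (Fin m)} (hz : lipCoeff f z ≠ ∞)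
    (x₁ x₂ : EuclideanSpace ℝ (Fin d))
    {μ₁ μ₂ : ProbabilityMeasure (EuclideanSpace ℝ (Fin d))}
    (h₁ : HasFiniteFirstMoment μ₁) (h₂ : HasFiniteFirstMoment μ₂) :
    ‖f (x₁, μ₁, z) - f (x₂, μ₂, z)‖ₑ ≤ lipCoeff f z * (‖x₁ - x₂‖ₑ + W1 μ₁ μ₂) := by
  -- In dimension zero the supremum is over an empty set, but all values of `f` coincide.
  rcases subsingleton_or_nontrivial (EuclideanSpace ℝ (Fin d)) with hs | hs
  · simp [Subsingleton.elim (f (x₁, μ₁, z)) (f (x₂, μ₂, z))]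
  have key : ∀ r : NNReal, 0 < r → ‖f (x₁, μ₁, z) - f (x₂, μ₂, z)‖ₑ ≤
      lipCoeff f z * (‖x₁ - x₂‖ₑ + W1 μ₁ μ₂ + 4 * r) := by
    intro r hr
    -- Go through the intermediate pair obtained by translating both x₁ and μ₁ by a small v.
    -- Excluding 0 makes it differ from (x₁, μ₁) in both coordinates; the other two exclusions make
    -- it differ from (x₂, μ₂), the laws being separated by their means.
    obtain ⟨v, hv, hvs⟩ := exists_small_ne
      ({0, x₂ - x₁, ∫ x, x ∂(μ₂ : Measure _) - ∫ x, x ∂(μ₁ : Measure _)} :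
        Finset (EuclideanSpace ℝ (Fin d))) (r := r) (by exact_mod_cast hr)
    simp only [Finset.mem_insert, Finset.mem_singleton, not_or] at hvs
    obtain ⟨hv0, hvx, hvm⟩ := hvs
    have hvr : ‖v‖ₑ ≤ r := by
      rw [enorm_eq_nnnorm]
      exact_mod_cast hv.le
    have a₁ : ‖f (x₁, μ₁, z) - f (x₁ + v, translateProba μ₁ v, z)‖ₑ ≤
        lipCoeff f z * (r + r) := by
      refine (enorm_sub_le_lipCoeff_mul_of_ne (by simpa using hv0) ?_ h₁ (h₁.translate v) z).trans ?_
      · intro h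
        have h' := integral_translate h₁ v
        rw [← h] at h'
        simp [hv0] at h'
      · gcongr
        · simpa using hvr
        · exact (W1_translate_self_le μ₁ v).trans hvr
    have a₂ : ‖f (x₁ + v, translateProba μ₁ v, z) - f (x₂, μ₂, z)‖ₑ ≤
        lipCoeff f z * ((‖x₁ - x₂‖ₑ + r) + (W1 μ₁ μ₂ + r)) := by
      refine (enorm_sub_le_lipCoeff_mul_of_ne ?_ ?_ (h₁.translate v) h₂ z).trans ?_
      · rintro rfl
        simp at hvx
      · intro h
        have h' := integral_translate h₁ v
        rw [h] at h'
        exact hvm (by rw [h']; abel)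
      · gcongr
        · rw [add_sub_right_comm]
          exact (enorm_add_le _ _).trans (by gcongr)
        · exact (W1_translate_le μ₁ μ₂ v).trans (by gcongr)
    calc ‖f (x₁, μ₁, z) - f (x₂, μ₂, z)‖ₑ
        = ‖(f (x₁, μ₁, z) - f (x₁ + v, translateProba μ₁ v, z)) +
          (f (x₁ + v, translateProba μ₁ v, z) - f (x₂, μ₂, z))‖ₑ := by rw [sub_add_sub_cancel]
      _ ≤ _ := enorm_add_le _ _
      _ ≤ _ := add_le_add a₁ a₂
      _ = _ := by ring
  -- Finiteness of the coefficient is needed here, for its product with 4r to vanish as r → 0.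
  have hlim : Tendsto (fun r : NNReal => lipCoeff f z * (‖x₁ - x₂‖ₑ + W1 μ₁ μ₂ + 4 * r))
      (𝓝[>] 0) (𝓝 (lipCoeff f z * (‖x₁ - x₂‖ₑ + W1 μ₁ μ₂ + 4 * (0 : NNReal)))) := by
    refine ENNReal.Tendsto.const_mul ?_ (Or.inr hz)
    refine tendsto_const_nhds.add (ENNReal.Tendsto.const_mul ?_ (Or.inr (by simp)))
    exact (ENNReal.tendsto_coe.2 tendsto_id).mono_left nhdsWithin_le_nhds
  have := ge_of_tendsto hlim (eventually_mem_nhdsWithin.mono fun r hr => key r hr)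
  simpa using this

end LipschitzCoefficient

/-! ### Coupling through finitely many nodes. -/

/-- Two finite weight vectors of equal total mass admit a coupling whose off-diagonal mass is
at most their `ℓ¹`-distance. -/
theorem exists_coupling_weights {ι : Type*} [Fintype ι] [DecidableEq ι] (a b : ι → ℝ)
    (ha : ∀ i, 0 ≤ a i) (hb : ∀ i, 0 ≤ b i) (hab : ∑ i, a i = ∑ i, b i) :
    ∃ π : ι → ι → ℝ, (∀ i j, 0 ≤ π i j) ∧ (∀ i, ∑ j, π i j = a i) ∧ (∀ j, ∑ i, π i j = b j) ∧
      ∑ i, ∑ j, (if i = j then 0 else π i j) ≤ ∑ i, |a i - b i| := by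
  set u : ι → ℝ := fun i => a i - min (a i) (b i) with hu
  set v : ι → ℝ := fun i => b i - min (a i) (b i) with hv
  set s : ℝ := ∑ i, u i with hs
  have hu0 : ∀ i, 0 ≤ u i := fun i => sub_nonneg.2 (min_le_left _ _)
  have hv0 : ∀ i, 0 ≤ v i := fun i => sub_nonneg.2 (min_le_right _ _)
  have hs0 : 0 ≤ s := Finset.sum_nonneg fun i _ => hu0 i
  have hsv : ∑ i, v i = s := by
    simp only [hs, hu, hv, Finset.sum_sub_distrib, hab]
  have hmul : ∀ i, u i * s / s = u i := by
    intro i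
    rcases eq_or_ne s 0 with h | h
    · have := (Finset.sum_eq_zero_iff_of_nonneg fun i _ => hu0 i).1 (hs ▸ h) i (Finset.mem_univ i)
      simp [this]
    · field_simp
  have hmul' : ∀ i, s * v i / s = v i := by
    intro i
    rcases eq_or_ne s 0 with h | h
    · have := (Finset.sum_eq_zero_iff_of_nonneg fun i _ => hv0 i).1 (hsv ▸ h) i (Finset.mem_univ i)
      simp [this]
    · field_simp
  -- Common mass stays on the diagonal, and the surplus `u` is spread over the deficit `v` in
  -- product form. If `s = 0`, both vanish and the division by zero does no harm.
  refine ⟨fun i j => (if i = j then min (a i) (b i) else 0) + u i * v j / s, ?_, ?_, ?_, ?_⟩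
  · intro i j
    have h1 : 0 ≤ u i * v j / s := div_nonneg (mul_nonneg (hu0 i) (hv0 j)) hs0
    have h2 : 0 ≤ (if i = j then min (a i) (b i) else 0) := by
      split_ifs
      exacts [le_min (ha i) (hb i), le_rfl]
    linarith
  · intro i
    rw [Finset.sum_add_distrib, ← Finset.sum_div, ← Finset.mul_sum, hsv, hmul]
    simp [hu]
  · intro j
    rw [Finset.sum_add_distrib, ← Finset.sum_div, ← Finset.sum_mul, ← hs, hmul']
    simp [hv]
  · calc ∑ i, ∑ j, (if i = j then 0 else
          ((if i = j then min (a i) (b i) else 0) + u i * v j / s))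
        ≤ ∑ i, ∑ j, u i * v j / s := by
          refine Finset.sum_le_sum fun i _ => Finset.sum_le_sum fun j _ => ?_
          have h1 : 0 ≤ u i * v j / s := div_nonneg (mul_nonneg (hu0 i) (hv0 j)) hs0
          split_ifs <;> simp [h1]
      _ = ∑ i, u i := by
          refine Finset.sum_congr rfl fun i _ => ?_
          rw [← Finset.sum_div, ← Finset.mul_sum, hsv, hmul]
      _ ≤ ∑ i, |a i - b i| := by
          refine Finset.sum_le_sum fun i _ => ?_
          simp only [hu]
          rcases min_cases (a i) (b i) with h | h
          · rw [h.1]; simp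
          · rw [h.1]; exact le_abs_self _

section Quantization

variable {E : Type*} [MeasurableSpace E]

/-- The conditional law obtained by weighting `μ` with the density `φ`; it is the zero measure
when the total weight vanishes. -/
noncomputable def weightedLaw (μ : Measure E) (φ : E → ℝ) : Measure E :=
  (∫⁻ x, ENNReal.ofReal (φ x) ∂μ)⁻¹ • μ.withDensity fun x => ENNReal.ofReal (φ x)

variable {μ : Measure E} {φ : E → ℝ}

instance [SFinite μ] : SFinite (weightedLaw μ φ) := by
  unfold weightedLaw; infer_instance

/-- A vanishing weight needs no exclusion, since the measure with density is then zero as well. -/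
theorem smul_weightedLaw [IsFiniteMeasure μ] (hφ1 : ∀ x, φ x ≤ 1) :
    (∫⁻ x, ENNReal.ofReal (φ x) ∂μ) • weightedLaw μ φ =
      μ.withDensity fun x => ENNReal.ofReal (φ x) := by
  have htop : ∫⁻ x, ENNReal.ofReal (φ x) ∂μ ≠ ∞ := by
    refine ne_top_of_le_ne_top (measure_ne_top μ Set.univ) ?_
    refine (lintegral_mono fun x => ENNReal.ofReal_le_one.2 (hφ1 x)).trans ?_
    simp
  rcases eq_or_ne (∫⁻ x, ENNReal.ofReal (φ x) ∂μ) 0 with h | h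
  · have : μ.withDensity (fun x => ENNReal.ofReal (φ x)) = 0 := by
      rw [← Measure.measure_univ_eq_zero, withDensity_apply _ MeasurableSet.univ]
      simpa using h
    rw [this, h, zero_smul]
  · rw [weightedLaw, smul_smul, ENNReal.mul_inv_cancel h htop, one_smul]

theorem weightedLaw_univ [IsFiniteMeasure μ] (hφ1 : ∀ x, φ x ≤ 1)
    (h : ∫⁻ x, ENNReal.ofReal (φ x) ∂μ ≠ 0) : weightedLaw μ φ Set.univ = 1 := by
  have htop : ∫⁻ x, ENNReal.ofReal (φ x) ∂μ ≠ ∞ := by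
    refine ne_top_of_le_ne_top (measure_ne_top μ Set.univ) ?_
    refine (lintegral_mono fun x => ENNReal.ofReal_le_one.2 (hφ1 x)).trans ?_
    simp
  rw [weightedLaw, Measure.smul_apply, withDensity_apply _ MeasurableSet.univ]
  simpa using ENNReal.inv_mul_cancel h htop

theorem sum_withDensity_ofReal {ι : Type*} [Fintype ι] {φ : ι → E → ℝ}
    (hφm : ∀ i, Measurable (φ i)) (hφ0 : ∀ i x, 0 ≤ φ i x) (hφ1 : ∀ x, ∑ i, φ i x = 1) :
    ∑ i, μ.withDensity (fun x => ENNReal.ofReal (φ i x)) = μ := by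
  ext s hs
  simp only [Measure.coe_finsetSum, Finset.sum_apply]
  simp_rw [withDensity_apply _ hs]
  rw [← lintegral_finsetSum _ fun i _ => by have := hφm i; fun_prop]
  simp_rw [← ENNReal.ofReal_sum_of_nonneg fun i _ => hφ0 i _, hφ1]
  simp

end Quantization

section QuantizationBound

variable {E : Type*} [NormedAddCommGroup E] [MeasurableSpace E] [BorelSpace E]
  [SecondCountableTopology E]

/-- A partition of unity `φ` with nodes `y` bounds `W1` by the cost of moving each law to
the nodes, plus the discrepancy of the resulting weights. -/
theorem W1_le_of_partition {ι : Type*} [Fintype ι] {φ : ι → E → ℝ} (y : ι → E) {C : ℝ}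
    (hφm : ∀ i, Measurable (φ i)) (hφ0 : ∀ i x, 0 ≤ φ i x) (hφ1 : ∀ x, ∑ i, φ i x = 1)
    (hC : ∀ i j, ‖y i - y j‖ ≤ C) (μ ν : ProbabilityMeasure E) :
    W1 μ ν ≤ ∫⁻ x, ENNReal.ofReal (∑ i, φ i x * ‖x - y i‖) ∂(μ : Measure E) +
      ∫⁻ x, ENNReal.ofReal (∑ i, φ i x * ‖x - y i‖) ∂(ν : Measure E) +
      ENNReal.ofReal
        (C * ∑ i, |∫ x, φ i x ∂(μ : Measure E) - ∫ x, φ i x ∂(ν : Measure E)|) := by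
  classical
  have hle1 : ∀ i x, φ i x ≤ 1 := fun i x => by
    rw [← hφ1 x]
    exact Finset.single_le_sum (fun j _ => hφ0 j x) (Finset.mem_univ i)
  have hint : ∀ (κ : ProbabilityMeasure E) i, Integrable (φ i) (κ : Measure E) := fun κ i =>
    (integrable_const (1 : ℝ)).mono' (hφm i).aestronglyMeasurable
      (ae_of_all _ fun x => by rw [Real.norm_of_nonneg (hφ0 i x)]; exact hle1 i x)
  have hw : ∀ (κ : ProbabilityMeasure E) i, ∫⁻ x, ENNReal.ofReal (φ i x) ∂(κ : Measure E) =
      ENNReal.ofReal (∫ x, φ i x ∂(κ : Measure E)) := fun κ i =>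
    (ofReal_integral_eq_lintegral_ofReal (hint κ i) (ae_of_all _ (hφ0 i))).symm
  have hsum : ∀ κ : ProbabilityMeasure E, ∑ i, ∫ x, φ i x ∂(κ : Measure E) = 1 := fun κ => by
    rw [← integral_finsetSum _ fun i _ => hint κ i]
    simp [hφ1]
  have hpos : ∀ (κ : ProbabilityMeasure E) i, 0 ≤ ∫ x, φ i x ∂(κ : Measure E) := fun κ i =>
    integral_nonneg (hφ0 i)
  obtain ⟨π, hπ0, hπa, hπb, hπ⟩ := exists_coupling_weights
    (fun i => ∫ x, φ i x ∂(μ : Measure E)) (fun i => ∫ x, φ i x ∂(ν : Measure E))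
    (hpos μ) (hpos ν) (by rw [hsum, hsum])
  have hπa' : ∀ i, ∑ j, ENNReal.ofReal (π i j) = ∫⁻ x, ENNReal.ofReal (φ i x) ∂(μ : Measure E) :=
    fun i => by rw [← ENNReal.ofReal_sum_of_nonneg fun j _ => hπ0 i j, hπa, hw]
  have hπb' : ∀ j, ∑ i, ENNReal.ofReal (π i j) = ∫⁻ x, ENNReal.ofReal (φ j x) ∂(ν : Measure E) :=
    fun j => by rw [← ENNReal.ofReal_sum_of_nonneg fun i _ => hπ0 i j, hπb, hw]
  -- the coupling weights charge only pairs whose conditional laws have mass one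
  have hmassν : ∀ i j, ENNReal.ofReal (π i j) * weightedLaw (ν : Measure E) (φ j) Set.univ =
      ENNReal.ofReal (π i j) := by
    intro i j
    by_cases h : ∫⁻ x, ENNReal.ofReal (φ j x) ∂(ν : Measure E) = 0
    · rw [← hπb' j, Finset.sum_eq_zero_iff] at h
      simp [h i (Finset.mem_univ i)]
    · rw [weightedLaw_univ (hle1 j) h, mul_one]
  have hmassμ : ∀ i j, ENNReal.ofReal (π i j) * weightedLaw (μ : Measure E) (φ i) Set.univ =
      ENNReal.ofReal (π i j) := by
    intro i j
    by_cases h : ∫⁻ x, ENNReal.ofReal (φ i x) ∂(μ : Measure E) = 0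
    · rw [← hπa' i, Finset.sum_eq_zero_iff] at h
      simp [h j (Finset.mem_univ j)]
    · rw [weightedLaw_univ (hle1 i) h, mul_one]
  have hμsum : ∑ i, ∑ j, ENNReal.ofReal (π i j) • weightedLaw (μ : Measure E) (φ i) =
      (μ : Measure E) := by
    simp_rw [← Finset.sum_smul, hπa', smul_weightedLaw (hle1 _)]
    exact sum_withDensity_ofReal hφm hφ0 hφ1
  have hνsum : ∑ i, ∑ j, ENNReal.ofReal (π i j) • weightedLaw (ν : Measure E) (φ j) =
      (ν : Measure E) := by
    rw [Finset.sum_comm]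
    simp_rw [← Finset.sum_smul, hπb', smul_weightedLaw (hle1 _)]
    exact sum_withDensity_ofReal hφm hφ0 hφ1
  -- Draw a pair of nodes with weights `π`, then a point from each of the two conditional laws,
  -- independently.
  let γ : Measure (E × E) := ∑ i, ∑ j, ENNReal.ofReal (π i j) •
    (weightedLaw (μ : Measure E) (φ i)).prod (weightedLaw (ν : Measure E) (φ j))
  have hγ : ∀ g : E × E → ℝ≥0∞, ∫⁻ p, g p ∂γ = ∑ i, ∑ j, ENNReal.ofReal (π i j) *
      ∫⁻ p, g p ∂(weightedLaw (μ : Measure E) (φ i)).prod (weightedLaw (ν : Measure E) (φ j)) := by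
    intro g
    simp [γ, lintegral_smul_measure]
  have hγ₁ : γ.map Prod.fst = (μ : Measure E) := by
    ext s hs
    rw [Measure.map_apply measurable_fst hs]
    conv_rhs => rw [← hμsum]
    simp only [γ, Measure.coe_finsetSum, Finset.sum_apply, Measure.smul_apply, smul_eq_mul]
    refine Finset.sum_congr rfl fun i _ => Finset.sum_congr rfl fun j _ => ?_
    rw [← Set.prod_univ, Measure.prod_prod, mul_left_comm, hmassν, mul_comm]
  have hγ₂ : γ.map Prod.snd = (ν : Measure E) := by
    ext s hs
    rw [Measure.map_apply measurable_snd hs]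
    conv_rhs => rw [← hνsum]
    simp only [γ, Measure.coe_finsetSum, Finset.sum_apply, Measure.smul_apply, smul_eq_mul]
    refine Finset.sum_congr rfl fun i _ => Finset.sum_congr rfl fun j _ => ?_
    rw [← Set.univ_prod, Measure.prod_prod, ← mul_assoc, hmassμ]
  have hcost : ∀ κ : ProbabilityMeasure E,
      ∑ i, (∫⁻ x, ENNReal.ofReal (φ i x) ∂(κ : Measure E)) *
        ∫⁻ x, ‖x - y i‖ₑ ∂weightedLaw (κ : Measure E) (φ i) =
      ∫⁻ x, ENNReal.ofReal (∑ i, φ i x * ‖x - y i‖) ∂(κ : Measure E) := by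
    intro κ
    have : ∀ x, ENNReal.ofReal (∑ i, φ i x * ‖x - y i‖) =
        ∑ i, ENNReal.ofReal (φ i x) * ‖x - y i‖ₑ := fun x => by
      rw [ENNReal.ofReal_sum_of_nonneg fun i _ => mul_nonneg (hφ0 i x) (norm_nonneg _)]
      simp_rw [ENNReal.ofReal_mul (hφ0 _ x), ofReal_norm]
    simp_rw [this]
    rw [lintegral_finsetSum _ fun i _ => by have := hφm i; fun_prop]
    refine Finset.sum_congr rfl fun i _ => ?_
    rw [← smul_eq_mul, ← lintegral_smul_measure, smul_weightedLaw (hle1 i),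
      lintegral_withDensity_eq_lintegral_mul _ (by have := hφm i; fun_prop) (by fun_prop)]
    rfl
  refine (W1_le_of_coupling γ hγ₁ hγ₂).trans ?_
  rw [hγ]
  calc ∑ i, ∑ j, ENNReal.ofReal (π i j) * ∫⁻ p, ‖p.1 - p.2‖ₑ
        ∂(weightedLaw (μ : Measure E) (φ i)).prod (weightedLaw (ν : Measure E) (φ j))
      ≤ ∑ i, ∑ j, (ENNReal.ofReal (π i j) * ∫⁻ x, ‖x - y i‖ₑ ∂weightedLaw (μ : Measure E) (φ i) +
          ENNReal.ofReal (π i j) * ∫⁻ x, ‖x - y j‖ₑ ∂weightedLaw (ν : Measure E) (φ j) +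
          ENNReal.ofReal (π i j) * ‖y i - y j‖ₑ) := by
        refine Finset.sum_le_sum fun i _ => Finset.sum_le_sum fun j _ => ?_
        -- Travel from the first point to its node, between the nodes, then to the second point.
        refine (mul_le_mul_right (lintegral_mono (g := fun p : E × E =>
          ‖p.1 - y i‖ₑ + ‖p.2 - y j‖ₑ + ‖y i - y j‖ₑ) fun p => ?_) _).trans ?_
        · have : p.1 - p.2 = (p.1 - y i) - (p.2 - y j) + (y i - y j) := by abel
          rw [this]
          exact (enorm_add_le _ _).trans (add_le_add_left enorm_sub_le _)
        · rw [lintegral_add_right _ measurable_const, lintegral_add_left (by fun_prop)]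
          rw [lintegral_const]
          have e1 : ∫⁻ p, ‖p.1 - y i‖ₑ ∂(weightedLaw (μ : Measure E) (φ i)).prod
              (weightedLaw (ν : Measure E) (φ j)) =
              weightedLaw (ν : Measure E) (φ j) Set.univ *
                ∫⁻ x, ‖x - y i‖ₑ ∂weightedLaw (μ : Measure E) (φ i) := by
            rw [← smul_eq_mul, ← lintegral_smul_measure, ← Measure.map_fst_prod,
              lintegral_map (by fun_prop) measurable_fst]
          have e2 : ∫⁻ p, ‖p.2 - y j‖ₑ ∂(weightedLaw (μ : Measure E) (φ i)).prod
              (weightedLaw (ν : Measure E) (φ j)) =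
              weightedLaw (μ : Measure E) (φ i) Set.univ *
                ∫⁻ x, ‖x - y j‖ₑ ∂weightedLaw (ν : Measure E) (φ j) := by
            rw [← smul_eq_mul, ← lintegral_smul_measure, ← Measure.map_snd_prod,
              lintegral_map (by fun_prop) measurable_snd]
          rw [e1, e2, ← Set.univ_prod_univ, Measure.prod_prod, mul_add, mul_add, ← mul_assoc,
            hmassν, ← mul_assoc, hmassμ, mul_comm ‖y i - y j‖ₑ, ← mul_assoc, ← mul_assoc, hmassμ,
            hmassν]
    _ = _ + _ + ∑ i, ∑ j, ENNReal.ofReal (π i j) * ‖y i - y j‖ₑ := by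
        simp only [Finset.sum_add_distrib]
        rfl
    _ ≤ _ := by
        gcongr
        · simp_rw [← Finset.sum_mul, hπa']
          exact (hcost μ).le
        · rw [Finset.sum_comm]
          simp_rw [← Finset.sum_mul, hπb']
          exact (hcost ν).le
        · have hC0 : ∀ i : ι, 0 ≤ C := fun i => (norm_nonneg _).trans (hC i i)
          calc ∑ i, ∑ j, ENNReal.ofReal (π i j) * ‖y i - y j‖ₑ
              = ENNReal.ofReal (∑ i, ∑ j, π i j * ‖y i - y j‖) := by
                rw [ENNReal.ofReal_sum_of_nonneg fun i _ => Finset.sum_nonneg fun j _ =>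
                  mul_nonneg (hπ0 i j) (norm_nonneg _)]
                refine Finset.sum_congr rfl fun i _ => ?_
                rw [ENNReal.ofReal_sum_of_nonneg fun j _ => mul_nonneg (hπ0 i j) (norm_nonneg _)]
                simp_rw [ENNReal.ofReal_mul (hπ0 _ _), ofReal_norm]
            _ ≤ _ := by
                refine ENNReal.ofReal_le_ofReal ?_
                rcases isEmpty_or_nonempty ι with h | ⟨⟨i₀⟩⟩
                · simp
                refine le_trans ?_ (mul_le_mul_of_nonneg_left hπ (hC0 i₀))
                rw [Finset.mul_sum]
                refine Finset.sum_le_sum fun i _ => ?_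
                rw [Finset.mul_sum]
                refine Finset.sum_le_sum fun j _ => ?_
                -- Equal nodes cost nothing, so only the off-diagonal mass is paid for.
                split_ifs with h
                · simp [h]
                · rw [mul_comm]
                  exact mul_le_mul_of_nonneg_right (hC i j) (hπ0 i j)

end QuantizationBound

/-- The excess over a level replaces the usual tail integral because it is a Lipschitz function of
the norm, hence an admissible test. -/
theorem tendsto_integral_norm_sub_max {α F : Type*} [MeasurableSpace α] [NormedAddCommGroup F]
    {μ : Measure α} {h : α → F} (hh : Integrable h μ) :
    Tendsto (fun n : ℕ => ∫ x, max (‖h x‖ - n) 0 ∂μ) atTop (𝓝 0) := by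
  have hlim := tendsto_integral_of_dominated_convergence (μ := μ)
    (F := fun (n : ℕ) x => max (‖h x‖ - n) 0) (f := fun _ => 0) (fun x => ‖h x‖)
    (fun n => (hh.norm.1.sub aestronglyMeasurable_const).sup aestronglyMeasurable_const) hh.norm
    (fun n => ae_of_all _ fun x => ?_) (ae_of_all _ fun x => ?_)
  · simpa using hlim
  · rw [Real.norm_of_nonneg (le_max_right _ _)]
    exact max_le (by simp) (norm_nonneg _)
  · obtain ⟨N, hN⟩ := exists_nat_ge ‖h x‖
    refine tendsto_const_nhds.congr' (eventually_atTop.2 ⟨N, fun n hn => ?_⟩)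
    have : (N : ℝ) ≤ n := by exact_mod_cast hn
    exact (max_eq_right (by linarith)).symm

/-! ### Lipschitz partitions of unity and W₁. -/

section TestFamily

variable {E : Type*} [NormedAddCommGroup E]

/-- Running maximum of the bump functions `min 1 (2 - ‖x - y j‖ / ρ)`, `j < n`, and `0`. -/
noncomputable def bumpMax (y : ℕ → E) (ρ : ℝ) : ℕ → E → ℝ
  | 0, _ => 0
  | n + 1, x => max (bumpMax y ρ n x) (min 1 (2 - ‖x - y n‖ / ρ))

variable (y : ℕ → E) {ρ : ℝ}

theorem bumpMax_nonneg (n : ℕ) (x : E) : 0 ≤ bumpMax y ρ n x := by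
  induction n with
  | zero => exact le_rfl
  | succ n ih => exact ih.trans (le_max_left _ _)

theorem bumpMax_le_one (n : ℕ) (x : E) : bumpMax y ρ n x ≤ 1 := by
  induction n with
  | zero => exact zero_le_one
  | succ n ih => exact max_le ih (min_le_left _ _)

theorem bumpMax_mono (x : E) : Monotone fun n => bumpMax y ρ n x :=
  monotone_nat_of_le_succ fun _ => le_max_left _ _

theorem lipschitzWith_bumpMax (hρ : 0 < ρ) (n : ℕ) :
    ∃ K, LipschitzWith K (bumpMax y ρ n) := by
  induction n with
  | zero => exact ⟨0, LipschitzWith.const 0⟩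
  | succ n ih =>
    obtain ⟨K, hK⟩ := ih
    have h : LipschitzWith (Real.toNNReal ρ⁻¹) fun x => 2 - ‖x - y n‖ / ρ := by
      refine LipschitzWith.of_dist_le_mul fun a b => ?_
      rw [Real.coe_toNNReal _ (inv_nonneg.2 hρ.le), Real.dist_eq, dist_eq_norm]
      have := abs_norm_sub_norm_le (b - y n) (a - y n)
      rw [sub_sub_sub_cancel_right, norm_sub_rev b a] at this
      calc |2 - ‖a - y n‖ / ρ - (2 - ‖b - y n‖ / ρ)|
          = |ρ⁻¹ * (‖b - y n‖ - ‖a - y n‖)| := by congr 1; ring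
        _ = ρ⁻¹ * |‖b - y n‖ - ‖a - y n‖| := by
          rw [abs_mul, abs_of_nonneg (inv_nonneg.2 hρ.le)]
        _ ≤ ρ⁻¹ * ‖a - b‖ := mul_le_mul_of_nonneg_left this (inv_nonneg.2 hρ.le)
    exact ⟨_, hK.max (h.const_min 1)⟩

/-- Beyond distance 2ρ from `y n` the new bump is nonpositive and cannot raise the maximum, so the
increment lives within 2ρ of its node. -/
theorem bumpMax_succ_sub_mul_norm_le (hρ : 0 < ρ) (n : ℕ) (x : E) :
    (bumpMax y ρ (n + 1) x - bumpMax y ρ n x) * ‖x - y n‖ ≤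
      (bumpMax y ρ (n + 1) x - bumpMax y ρ n x) * (2 * ρ) := by
  rcases le_total ‖x - y n‖ (2 * ρ) with h | h
  · exact mul_le_mul_of_nonneg_left h (sub_nonneg.2 (bumpMax_mono y x n.le_succ))
  · have h1 : min 1 (2 - ‖x - y n‖ / ρ) ≤ bumpMax y ρ n x := by
      refine (min_le_right _ _).trans (le_trans ?_ (bumpMax_nonneg y n x))
      rw [sub_nonpos, le_div_iff₀ hρ]
      exact h
    have : bumpMax y ρ (n + 1) x = bumpMax y ρ n x := max_eq_left h1
    simp [this]

theorem bumpMax_eventually_eq_one (hy : DenseRange y) (hρ : 0 < ρ) (x : E) :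
    ∀ᶠ n in atTop, bumpMax y ρ n x = 1 := by
  obtain ⟨j, hj⟩ := hy.exists_dist_lt x hρ
  refine eventually_atTop.2 ⟨j + 1, fun n hn => le_antisymm (bumpMax_le_one y n x) ?_⟩
  refine le_trans ?_ (bumpMax_mono y x hn)
  refine le_max_of_le_right (le_min le_rfl ?_)
  have : ‖x - y j‖ / ρ ≤ 1 := by
    rw [div_le_one hρ, ← dist_eq_norm]
    exact hj.le
  linarith

theorem sum_bumpMax_succ_sub (n : ℕ) (x : E) :
    ∑ i : Fin n, (bumpMax y ρ (i + 1) x - bumpMax y ρ i x) = bumpMax y ρ n x := by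
  rw [Fin.sum_univ_eq_sum_range (fun i => bumpMax y ρ (i + 1) x - bumpMax y ρ i x) n,
    Finset.sum_range_sub (fun i => bumpMax y ρ i x) n]
  simp [bumpMax]

variable [MeasurableSpace E] [BorelSpace E]

theorem tendsto_integral_one_sub_bumpMax (ν : ProbabilityMeasure E) (hy : DenseRange y)
    (hρ : 0 < ρ) :
    Tendsto (fun n : ℕ => ∫ x, (1 - bumpMax y ρ n x) ∂(ν : Measure E)) atTop (𝓝 0) := by
  have h := tendsto_integral_of_dominated_convergence (μ := (ν : Measure E))
    (F := fun (n : ℕ) x => 1 - bumpMax y ρ n x) (f := fun _ => 0) (fun _ => 1)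
    (fun n => ?_) (integrable_const _) (fun n => ae_of_all _ fun x => ?_)
    (ae_of_all _ fun x => ?_)
  · simpa using h
  · obtain ⟨K, hK⟩ := lipschitzWith_bumpMax y hρ n
    exact (continuous_const.sub hK.continuous).aestronglyMeasurable
  · have h0 := bumpMax_nonneg y (ρ := ρ) n x
    have h1 := bumpMax_le_one y (ρ := ρ) n x
    rw [Real.norm_of_nonneg (by linarith)]
    linarith
  · refine tendsto_const_nhds.congr' ((bumpMax_eventually_eq_one y hy hρ x).mono fun n hn => ?_)
    simp [hn]

variable [SecondCountableTopology E]

/-- Up to an arbitrarily small error, the Wasserstein distance to a given law of finite first moment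
is controlled by finitely many Lipschitz test functions. -/
theorem exists_lipschitz_test_family {ν : ProbabilityMeasure E} (hν : HasFiniteFirstMoment ν)
    {r : ℝ} (hr : 0 < r) :
    ∃ (ι : Type) (_ : Fintype ι) (φ : ι → E → ℝ) (C : NNReal),
      (∀ i, ∃ K, LipschitzWith K (φ i)) ∧
      ∀ μ : ProbabilityMeasure E, HasFiniteFirstMoment μ →
        W1 μ ν ≤ ENNReal.ofReal r +
          C * ∑ i, ‖∫ x, φ i x ∂(μ : Measure E) - ∫ x, φ i x ∂(ν : Measure E)‖ₑ := by
  -- The cost function `c` below has ν-integral at most 4ρ, and this integral enters twice.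
  set ρ : ℝ := r / 8 with hρdef
  have hρ : 0 < ρ := by positivity
  set y : ℕ → E := TopologicalSpace.denseSeq E with hydef
  have hy : DenseRange y := TopologicalSpace.denseRange_denseSeq E
  obtain ⟨R, hR⟩ := ((tendsto_integral_norm_sub_max
    (LipschitzWith.id.integrable_of_hasFiniteFirstMoment hν)).eventually (gt_mem_nhds hρ)).exists
  simp only [id] at hR
  -- `M` is chosen after `R`: the mass missed by the bumps must be small even when multiplied by
  -- `R`.
  obtain ⟨M, hM⟩ := (((tendsto_integral_one_sub_bumpMax y ν hy hρ).const_mul (R : ℝ)).eventually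
    (gt_mem_nhds (by simpa using hρ))).exists
  have hlipM : ∀ n, ∃ K, LipschitzWith K (bumpMax y ρ n) := lipschitzWith_bumpMax y hρ
  -- Increments of the running maximum go to the points of the dense sequence; the remainder,
  -- indexed by `none`, goes to the origin.
  let φ : Option (Fin M) → E → ℝ := fun o x =>
    o.elim (1 - bumpMax y ρ M x) fun i => bumpMax y ρ (i + 1) x - bumpMax y ρ i x
  let nodes : Option (Fin M) → E := fun o => o.elim 0 fun i => y i
  -- A Lipschitz majorant of the transport cost to the nodes. It becomes an additional test
  -- function, which is how the cost under μ is compared with the cost under ν.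
  let c : E → ℝ := fun x => 2 * ρ + max (‖x‖ - R) 0 + R * (1 - bumpMax y ρ M x)
  have hφlip : ∀ i, ∃ K, LipschitzWith K (φ i) := by
    rintro (_ | i)
    · obtain ⟨K, hK⟩ := hlipM M
      exact ⟨_, (LipschitzWith.const 1).sub hK⟩
    · obtain ⟨K, hK⟩ := hlipM i
      obtain ⟨K', hK'⟩ := hlipM (i + 1)
      exact ⟨_, hK'.sub hK⟩
  have hφ0 : ∀ i x, 0 ≤ φ i x := by
    rintro (_ | i) x
    · exact sub_nonneg.2 (bumpMax_le_one y M x)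
    · exact sub_nonneg.2 (bumpMax_mono y x (Nat.le_succ _))
  have hφ1 : ∀ x, ∑ i, φ i x = 1 := by
    intro x
    rw [Fintype.sum_option]
    simp only [φ, Option.elim, sum_bumpMax_succ_sub]
    ring
  have hφm : ∀ i, Measurable (φ i) := fun i => (hφlip i).choose_spec.continuous.measurable
  have hclip : ∃ K, LipschitzWith K c := by
    obtain ⟨K, hK⟩ := hlipM M
    have h1 : LipschitzWith 1 fun x : E => max (‖x‖ - R) 0 := by
      have : LipschitzWith 1 fun x : E => ‖x‖ - R := by
        simpa using lipschitzWith_one_norm.sub (LipschitzWith.const (R : ℝ))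
      exact this.max_const 0
    have h2 := (lipschitzWith_smul (α := ℝ) (R : ℝ)).comp ((LipschitzWith.const (1 : ℝ)).sub hK)
    exact ⟨_, ((LipschitzWith.const (2 * ρ)).add h1).add h2⟩
  have hc0 : ∀ x, 0 ≤ c x := fun x => by
    have h1 := bumpMax_le_one y (ρ := ρ) M x
    have h2 : 0 ≤ (R : ℝ) * (1 - bumpMax y ρ M x) :=
      mul_nonneg (Nat.cast_nonneg _) (by linarith)
    have h3 := le_max_right (‖x‖ - (R : ℝ)) 0
    simp only [c]
    linarith
  have hcost : ∀ x, ∑ i, φ i x * ‖x - nodes i‖ ≤ c x := by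
    intro x
    rw [Fintype.sum_option]
    have h0 := bumpMax_nonneg y (ρ := ρ) M x
    have h1 := bumpMax_le_one y (ρ := ρ) M x
    have hsum : ∑ i : Fin M, φ (some i) x * ‖x - nodes (some i)‖ ≤ 2 * ρ := by
      calc ∑ i : Fin M, φ (some i) x * ‖x - nodes (some i)‖
          ≤ ∑ i : Fin M, (bumpMax y ρ (i + 1) x - bumpMax y ρ i x) * (2 * ρ) :=
            Finset.sum_le_sum fun i _ => bumpMax_succ_sub_mul_norm_le y hρ i x
        _ = bumpMax y ρ M x * (2 * ρ) := by rw [← Finset.sum_mul, sum_bumpMax_succ_sub]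
        _ ≤ 1 * (2 * ρ) := by gcongr
        _ = 2 * ρ := one_mul _
    have hrest : φ none x * ‖x - nodes none‖ ≤
        max (‖x‖ - R) 0 + R * (1 - bumpMax y ρ M x) := by
      simp only [φ, nodes, Option.elim, sub_zero]
      have h2 : ‖x‖ ≤ max (‖x‖ - R) 0 + R := by
        have := le_max_left (‖x‖ - (R : ℝ)) 0
        linarith
      have h3 := le_max_right (‖x‖ - (R : ℝ)) 0
      nlinarith
    simp only [c]
    linarith
  obtain ⟨Kc, hKc⟩ := hclip
  have hcν : ∫ x, c x ∂(ν : Measure E) ≤ 4 * ρ := by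
    have i1 : Integrable (fun x : E => max (‖x‖ - (R : ℝ)) 0) (ν : Measure E) := by
      have : LipschitzWith 1 fun x : E => ‖x‖ - (R : ℝ) := by
        simpa using lipschitzWith_one_norm.sub (LipschitzWith.const (R : ℝ))
      exact (this.max_const 0).integrable_of_hasFiniteFirstMoment hν
    have i2 : Integrable (fun x : E => (1 - bumpMax y ρ M x)) (ν : Measure E) := by
      obtain ⟨K, hK⟩ := hlipM M
      exact ((LipschitzWith.const 1).sub hK).integrable_of_hasFiniteFirstMoment hν
    simp only [c]
    rw [integral_add (f := fun x => 2 * ρ + max (‖x‖ - (R : ℝ)) 0)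
        ((integrable_const _).add i1) (i2.const_mul _),
      integral_add (integrable_const _) i1, integral_const_mul (R : ℝ)]
    simp only [integral_const, probReal_univ, one_smul]
    linarith
  refine ⟨Option (Option (Fin M)), inferInstance, fun o => o.elim c φ,
    max 1 (∑ i, ∑ j, ‖nodes i - nodes j‖₊), ?_, fun μ hμ => ?_⟩
  · rintro (_ | i)
    exacts [⟨Kc, hKc⟩, hφlip i]
  have hcL : ∀ κ : ProbabilityMeasure E, HasFiniteFirstMoment κ →
      ∫⁻ x, ENNReal.ofReal (∑ i, φ i x * ‖x - nodes i‖) ∂(κ : Measure E) ≤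
        ENNReal.ofReal (∫ x, c x ∂(κ : Measure E)) := fun κ hκ => by
    rw [ofReal_integral_eq_lintegral_ofReal (hKc.integrable_of_hasFiniteFirstMoment hκ)
      (ae_of_all _ hc0)]
    exact lintegral_mono fun x => ENNReal.ofReal_le_ofReal (hcost x)
  have hcμ : ENNReal.ofReal (∫ x, c x ∂(μ : Measure E)) ≤
      ENNReal.ofReal (∫ x, c x ∂(ν : Measure E)) +
        ‖∫ x, c x ∂(μ : Measure E) - ∫ x, c x ∂(ν : Measure E)‖ₑ := by
    rw [← ofReal_norm, ← ENNReal.ofReal_add (integral_nonneg hc0) (norm_nonneg _)]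
    refine ENNReal.ofReal_le_ofReal ?_
    have := le_abs_self (∫ x, c x ∂(μ : Measure E) - ∫ x, c x ∂(ν : Measure E))
    rw [Real.norm_eq_abs]
    linarith
  set C : NNReal := ∑ i, ∑ j, ‖nodes i - nodes j‖₊ with hCdef
  have hC : ∀ i j, ‖nodes i - nodes j‖ ≤ (C : ℝ) := by
    intro i j
    rw [← coe_nnnorm, NNReal.coe_le_coe]
    exact (Finset.single_le_sum (f := fun j => ‖nodes i - nodes j‖₊) (fun _ _ => zero_le)
      (Finset.mem_univ j)).trans
      (Finset.single_le_sum (f := fun i => ∑ j, ‖nodes i - nodes j‖₊) (fun _ _ => zero_le)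
      (Finset.mem_univ i))
  have hD : ENNReal.ofReal
      (C * ∑ i, |∫ x, φ i x ∂(μ : Measure E) - ∫ x, φ i x ∂(ν : Measure E)|) =
      C * ∑ i, ‖∫ x, φ i x ∂(μ : Measure E) - ∫ x, φ i x ∂(ν : Measure E)‖ₑ := by
    rw [ENNReal.ofReal_mul C.coe_nonneg, ENNReal.ofReal_coe_nnreal,
      ENNReal.ofReal_sum_of_nonneg fun i _ => abs_nonneg _]
    simp_rw [← Real.norm_eq_abs, ofReal_norm]
  refine (W1_le_of_partition nodes hφm hφ0 hφ1 hC μ ν).trans ?_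
  rw [hD]
  have hS : ∀ g : Option (Option (Fin M)) → ℝ≥0∞, ∑ i, g i = g none + ∑ i, g (some i) :=
    Fintype.sum_option
  rw [hS]
  simp only [Option.elim]
  have hr8 : ENNReal.ofReal (∫ x, c x ∂(ν : Measure E)) +
      ENNReal.ofReal (∫ x, c x ∂(ν : Measure E)) ≤ ENNReal.ofReal r := by
    rw [← ENNReal.ofReal_add (integral_nonneg hc0) (integral_nonneg hc0)]
    exact ENNReal.ofReal_le_ofReal (by linarith)
  have hmax1 : (1 : ℝ≥0∞) ≤ ((max 1 C : NNReal) : ℝ≥0∞) := by exact_mod_cast le_max_left 1 C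
  have hmaxC : (C : ℝ≥0∞) ≤ ((max 1 C : NNReal) : ℝ≥0∞) := by exact_mod_cast le_max_right 1 C
  calc _ ≤ (ENNReal.ofReal (∫ x, c x ∂(ν : Measure E)) +
          1 * ‖∫ x, c x ∂(μ : Measure E) - ∫ x, c x ∂(ν : Measure E)‖ₑ) +
        ENNReal.ofReal (∫ x, c x ∂(ν : Measure E)) +
        C * ∑ i, ‖∫ x, φ i x ∂(μ : Measure E) - ∫ x, φ i x ∂(ν : Measure E)‖ₑ := by
        rw [one_mul]
        gcongr
        exacts [(hcL μ hμ).trans hcμ, hcL ν hν]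
    _ = (ENNReal.ofReal (∫ x, c x ∂(ν : Measure E)) +
          ENNReal.ofReal (∫ x, c x ∂(ν : Measure E))) +
        (1 * ‖∫ x, c x ∂(μ : Measure E) - ∫ x, c x ∂(ν : Measure E)‖ₑ +
        C * ∑ i, ‖∫ x, φ i x ∂(μ : Measure E) - ∫ x, φ i x ∂(ν : Measure E)‖ₑ) := by ring
    _ ≤ _ := by
        rw [mul_add]
        gcongr

end TestFamily

/-! ### Independence of state and noise along a recursion. -/

section Independence

variable {Ω : Type*} [MeasurableSpace Ω] {P : Measure Ω}

/-- Subfamilies of an independent family over disjoint index sets are independent. -/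
theorem iIndepFun_restrict_disjoint {α β : Type*} [MeasurableSpace β] {ξ : α → Ω → β}
    (hξ : iIndepFun ξ P) (hm : ∀ a, Measurable (ξ a)) {S T : Set α} (hST : Disjoint S T) :
    IndepFun (fun ω (s : S) => ξ s ω) (fun ω (t : T) => ξ t ω) P := by
  have key := indep_iSup_of_disjoint (fun a => (hm a).comap_le) hξ.iIndep hST
  have hle : ∀ A : Set α, MeasurableSpace.comap (fun ω (s : A) => ξ s ω) MeasurableSpace.pi ≤
      ⨆ a ∈ A, MeasurableSpace.comap (ξ a) inferInstance := by
    intro A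
    rw [← measurable_iff_comap_le]
    refine (@measurable_pi_iff _ _ _ (_) _ _).2 fun s => ?_
    rw [measurable_iff_comap_le]
    exact le_iSup₂_of_le (s : α) s.2 le_rfl
  exact indep_of_indep_of_le_left (indep_of_indep_of_le_right key (hle T)) (hle S)

/-- The two hypotheses make the law of the triple a full product, which can be reassociated. -/
theorem IndepFun.prodMk_left_of_indepFun [IsProbabilityMeasure P] {F G K : Type*}
    [MeasurableSpace F] [MeasurableSpace G] [MeasurableSpace K]
    {X : Ω → F} {U : Ω → G} {V : Ω → K} (hX : Measurable X) (hU : Measurable U) (hV : Measurable V)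
    (h : IndepFun X (fun ω => (U ω, V ω)) P) (hUV : IndepFun U V P) :
    IndepFun (fun ω => (X ω, U ω)) V P := by
  have hXU : IndepFun X U P := h.comp measurable_id measurable_fst
  have e1 := h.map_prod_eq_prod_map_map hX.aemeasurable (hU.prodMk hV).aemeasurable
  have e2 := hUV.map_prod_eq_prod_map_map hU.aemeasurable hV.aemeasurable
  have e3 := hXU.map_prod_eq_prod_map_map hX.aemeasurable hU.aemeasurable
  rw [indepFun_iff_map_prod_eq_prod_map_map (hX.prodMk hU).aemeasurable hV.aemeasurable, e3]
  have := Measure.isProbabilityMeasure_map (μ := P) hX.aemeasurable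
  have := Measure.isProbabilityMeasure_map (μ := P) hU.aemeasurable
  have := Measure.isProbabilityMeasure_map (μ := P) hV.aemeasurable
  have e4 : P.map (fun ω => ((X ω, U ω), V ω)) =
      (P.map fun ω => (X ω, (U ω, V ω))).map MeasurableEquiv.prodAssoc.symm := by
    rw [Measure.map_map (MeasurableEquiv.measurable _) (hX.prodMk (hU.prodMk hV))]
    rfl
  rw [e4, e1, e2, ← Measure.prodAssoc_prod,
    Measure.map_map (MeasurableEquiv.measurable _) (MeasurableEquiv.measurable _)]
  simp

/-- In a recursion driven by noise that is independent of the initial state and of its own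
future, the state is independent of the present and future noise. -/
theorem indepFun_recursion [IsProbabilityMeasure P] {F G : Type*} [MeasurableSpace F]
    [MeasurableSpace G] {S : ℕ → Ω → F} {U : ℕ → Ω → G} {H : ℕ → F × G → F}
    (hS : ∀ n, Measurable (S n)) (hU : ∀ n, Measurable (U n)) (hH : ∀ n, Measurable (H n))
    (h0 : IndepFun (S 0) (fun ω n => U n ω) P)
    (hfut : ∀ n, IndepFun (U n) (fun ω k => U (n + 1 + k) ω) P)
    (hstep : ∀ n, ∀ᵐ ω ∂P, S (n + 1) ω = H n (S n ω, U n ω)) (n : ℕ) :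
    IndepFun (S n) (U n) P := by
  -- The induction closes only if independence from the entire future noise is carried along.
  have key : ∀ n, IndepFun (S n) (fun ω k => U (n + k) ω) P := by
    intro n
    induction n with
    | zero => simpa using h0
    | succ n ih =>
      have h1 : IndepFun (S n) (fun ω => (U n ω, fun k => U (n + 1 + k) ω)) P := by
        have := ih.comp (φ := id) (ψ := fun u : ℕ → G => (u 0, fun k => u (1 + k)))
          measurable_id (by fun_prop)
        simpa [Function.comp_def, add_assoc] using this
      have h2 := IndepFun.prodMk_left_of_indepFun (hS n) (hU n)
        (measurable_pi_iff.2 fun k => hU (n + 1 + k)) h1 (hfut n)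
      have h3 := h2.comp (hH n) measurable_id
      refine h3.congr ?_ (ae_of_all _ fun ω => rfl)
      filter_upwards [hstep n] with ω hω
      exact hω.symm
  have hev : Measurable fun u : ℕ → G => u 0 := measurable_pi_apply 0
  simpa [Function.comp_def] using (key n).comp measurable_id hev

end Independence

/-! ### Empirical measures. -/

section EmpiricalMeasure

variable {E : Type*} [MeasurableSpace E] {N : ℕ} [NeZero N]

theorem coe_empiricalMeasure (x : Fin N → E) :
    (empiricalMeasure x : Measure E) = (N : ℝ≥0∞)⁻¹ • ∑ i, Measure.dirac (x i) := rfl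

theorem lintegral_empiricalMeasure (x : Fin N → E) {g : E → ℝ≥0∞} (hg : Measurable g) :
    ∫⁻ a, g a ∂(empiricalMeasure x : Measure E) = (N : ℝ≥0∞)⁻¹ * ∑ i, g (x i) := by
  rw [coe_empiricalMeasure, lintegral_smul_measure, lintegral_finsetSum_measure, smul_eq_mul]
  simp_rw [lintegral_dirac' _ hg]

theorem integral_empiricalMeasure (x : Fin N → E) {g : E → ℝ} (hg : Measurable g) :
    ∫ a, g a ∂(empiricalMeasure x : Measure E) = (N : ℝ)⁻¹ * ∑ i, g (x i) := by
  rw [coe_empiricalMeasure, integral_smul_measure, integral_finsetSum_measure]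
  · simp_rw [integral_dirac' _ _ hg.stronglyMeasurable]
    simp
  · intro i _
    refine ⟨hg.aestronglyMeasurable, ?_⟩
    rw [HasFiniteIntegral, lintegral_dirac' _ hg.enorm]
    exact enorm_lt_top

theorem measurable_empiricalMeasure :
    Measurable (empiricalMeasure : (Fin N → E) → ProbabilityMeasure E) := by
  refine Measurable.subtype_mk (Measure.measurable_of_measurable_coe _ fun s hs => ?_)
  simp only [Measure.smul_apply, Measure.coe_finsetSum, Finset.sum_apply, smul_eq_mul,
    Measure.dirac_apply' _ hs]
  refine Measurable.const_mul (Finset.measurable_sum _ fun i _ => ?_) _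
  exact (measurable_one.indicator hs).comp (measurable_pi_apply i)

theorem empiricalMeasure_comp_perm (x : Fin N → E) (π : Equiv.Perm (Fin N)) :
    empiricalMeasure (fun i => x (π i)) = empiricalMeasure x := by
  refine Subtype.ext ?_
  change (empiricalMeasure (fun i => x (π i)) : Measure E) = (empiricalMeasure x : Measure E)
  rw [coe_empiricalMeasure, coe_empiricalMeasure, Equiv.sum_comp π fun i => Measure.dirac (x i)]

theorem hasFiniteFirstMoment_empiricalMeasure {E : Type*} [NormedAddCommGroup E]
    [MeasurableSpace E] [OpensMeasurableSpace E] (x : Fin N → E) :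
    HasFiniteFirstMoment (empiricalMeasure x) := by
  unfold HasFiniteFirstMoment
  rw [lintegral_empiricalMeasure x (by fun_prop)]
  refine ENNReal.mul_lt_top ?_ (ENNReal.sum_lt_top.2 fun i _ => enorm_lt_top)
  simpa using NeZero.pos N

end EmpiricalMeasure

/-! ### Second-moment bound for bounded averages. -/

section AverageDeviation

variable {E E' : Type*} [MeasurableSpace E] [MeasurableSpace E']

/-- Mean absolute deviation of an average of independent bounded variables. -/
theorem lintegral_enorm_average_sub_le {θ : Measure E'} [IsProbabilityMeasure θ] {g : E × E' → ℝ}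
    (hg : Measurable g) {R : ℝ} (hR0 : 0 ≤ R) (hR : ∀ p, |g p| ≤ R) {N : ℕ} (hN : 0 < N)
    (x : Fin N → E) :
    ∫⁻ u, ‖(N : ℝ)⁻¹ * ∑ i, g (x i, u i) - (N : ℝ)⁻¹ * ∑ i, ∫ z, g (x i, z) ∂θ‖ₑ
      ∂(Measure.pi fun _ : Fin N => θ) ≤ ENNReal.ofReal (R / √N) := by
  set κ := Measure.pi fun _ : Fin N => θ with hκ
  have hgi : ∀ i, Measurable fun z => g (x i, z) := fun i => hg.comp (by fun_prop)
  have hmem : ∀ i, MemLp (fun z => g (x i, z)) 2 θ := fun i =>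
    MemLp.of_bound (hgi i).aestronglyMeasurable R (ae_of_all _ fun z => hR _)
  have hmemκ : ∀ i, MemLp (fun u : Fin N → E' => g (x i, u i)) 2 κ := fun i =>
    (hmem i).comp_measurePreserving (measurePreserving_eval _ i)
  let S : (Fin N → E') → ℝ := ∑ i, fun u => g (x i, u i)
  have hSmem : MemLp S 2 κ := memLp_finsetSum' _ fun i _ => hmemκ i
  have hSval : ∀ u, S u = ∑ i, g (x i, u i) := fun u => by simp [S]
  have hSint : ∫ u, S u ∂κ = ∑ i, ∫ z, g (x i, z) ∂θ := by
    simp_rw [hSval]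
    rw [integral_finsetSum _ fun i _ => (hmemκ i).integrable one_le_two]
    refine Finset.sum_congr rfl fun i _ => ?_
    have hmp : MeasurePreserving (fun u : Fin N → E' => u i) κ θ := measurePreserving_eval _ i
    rw [← hmp.map_eq, integral_map hmp.measurable.aemeasurable
      ((hgi i).aestronglyMeasurable)]
  have hvar : Var[S; κ] ≤ N * R ^ 2 := by
    have hsum := variance_sum_pi hmem
    change Var[S; κ] = _ at hsum
    rw [hsum]
    calc ∑ i, Var[fun z => g (x i, z); θ] ≤ ∑ _i : Fin N, R ^ 2 := by
          refine Finset.sum_le_sum fun i _ => ?_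
          refine (variance_le_sq_of_bounded (a := -R) (b := R)
            (ae_of_all _ fun z => abs_le.1 (hR (x i, z))) (hgi i).aemeasurable).trans_eq ?_
          ring
      _ = N * R ^ 2 := by simp
  set T : (Fin N → E') → ℝ := fun u => |S u - ∫ v, S v ∂κ| with hT
  have hTmem : MemLp T 2 κ := (hSmem.sub (memLp_const _)).abs
  have hT1 : (∫ u, T u ∂κ) ^ 2 ≤ N * R ^ 2 := by
    -- Nonnegative variance of `T` means (E T)² ≤ E T², and E T² is the variance of `S`.
    have h1 := variance_nonneg T κ
    rw [variance_eq_sub hTmem] at h1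
    have h2 : ∫ u, (T ^ 2) u ∂κ = Var[S; κ] := by
      rw [variance_eq_integral hSmem.aemeasurable]
      simp [hT, sq_abs]
    linarith
  have hT2 : ∫ u, T u ∂κ ≤ √N * R := by
    refine (Real.le_sqrt_of_sq_le hT1).trans_eq ?_
    rw [Real.sqrt_mul (Nat.cast_nonneg _), Real.sqrt_sq hR0]
  have hNpos : (0 : ℝ) < N := by exact_mod_cast hN
  calc ∫⁻ u, ‖(N : ℝ)⁻¹ * ∑ i, g (x i, u i) - (N : ℝ)⁻¹ * ∑ i, ∫ z, g (x i, z) ∂θ‖ₑ ∂κ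
      = ∫⁻ u, ENNReal.ofReal ((N : ℝ)⁻¹ * T u) ∂κ := by
        refine lintegral_congr fun u => ?_
        rw [← mul_sub, ← ofReal_norm, norm_mul, Real.norm_of_nonneg (inv_nonneg.2 hNpos.le),
          ← hSval, ← hSint, Real.norm_eq_abs]
    _ = ENNReal.ofReal (∫ u, (N : ℝ)⁻¹ * T u ∂κ) :=
        (ofReal_integral_eq_lintegral_ofReal ((hTmem.integrable one_le_two).const_mul _)
          (ae_of_all _ fun u => mul_nonneg (inv_nonneg.2 hNpos.le) (abs_nonneg _))).symm
    _ ≤ ENNReal.ofReal (R / √N) := by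
        refine ENNReal.ofReal_le_ofReal ?_
        rw [integral_const_mul]
        calc (N : ℝ)⁻¹ * ∫ u, T u ∂κ ≤ (N : ℝ)⁻¹ * (√N * R) := by gcongr
          _ = R / √N := by
            have h := Real.mul_self_sqrt hNpos.le
            have h' : √(N : ℝ) ≠ 0 := (Real.sqrt_pos.2 hNpos).ne'
            nth_rewrite 1 [← h]
            field_simp

end AverageDeviation

/-! ### Random maps Lipschitz in mean and their transition operators. -/

section AverageStep

variable {E E' : Type*} [NormedAddCommGroup E] [MeasurableSpace E] [BorelSpace E]
  [SecondCountableTopology E] [MeasurableSpace E']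

/-- A random map `G(·, z)`, `z ∼ θ`, that is integrable at the origin and Lipschitz in mean. -/
structure IsMeanLipschitz (θ : Measure E') (G : E × E' → E) (L : NNReal) : Prop where
  measurable : Measurable G
  lintegral_zero : ∫⁻ z, ‖G (0, z)‖ₑ ∂θ < ∞
  lintegral_sub_le : ∀ x x', ∫⁻ z, ‖G (x, z) - G (x', z)‖ₑ ∂θ ≤ L * ‖x - x'‖ₑ

/-- The transition operator of the random map `G` applied to the function `φ`. -/
noncomputable def transition (θ : Measure E') (G : E × E' → E) (φ : E → ℝ) (x : E) : ℝ :=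
  ∫ z, φ (G (x, z)) ∂θ

variable {θ : Measure E'} {G : E × E' → E} {L : NNReal}

namespace IsMeanLipschitz

theorem lintegral_enorm_le (hG : IsMeanLipschitz θ G L) (x : E) :
    ∫⁻ z, ‖G (x, z)‖ₑ ∂θ ≤ ∫⁻ z, ‖G (0, z)‖ₑ ∂θ + L * ‖x‖ₑ := by
  have hm := hG.measurable
  calc ∫⁻ z, ‖G (x, z)‖ₑ ∂θ ≤ ∫⁻ z, (‖G (0, z)‖ₑ + ‖G (x, z) - G (0, z)‖ₑ) ∂θ := by
        refine lintegral_mono fun z => ?_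
        conv_lhs => rw [← add_sub_cancel (G (0, z)) (G (x, z))]
        exact enorm_add_le _ _
    _ = ∫⁻ z, ‖G (0, z)‖ₑ ∂θ + ∫⁻ z, ‖G (x, z) - G (0, z)‖ₑ ∂θ := by
        rw [lintegral_add_left (by fun_prop)]
    _ ≤ _ := by
        gcongr
        simpa using hG.lintegral_sub_le x 0

variable [IsProbabilityMeasure θ]

theorem integrable_comp (hG : IsMeanLipschitz θ G L) {K : NNReal} {φ : E → ℝ}
    (hφ : LipschitzWith K φ) (x : E) : Integrable (fun z => φ (G (x, z))) θ := by
  have hm := hG.measurable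
  have hφm := hφ.continuous.measurable
  have h1 : Integrable (fun z => ‖G (x, z)‖) θ := by
    refine ⟨Measurable.aestronglyMeasurable (by fun_prop), ?_⟩
    rw [HasFiniteIntegral]
    simp only [enorm_norm]
    exact (hG.lintegral_enorm_le x).trans_lt
      (ENNReal.add_lt_top.2 ⟨hG.lintegral_zero, ENNReal.mul_lt_top (by simp) enorm_lt_top⟩)
  refine ((h1.const_mul K).add (integrable_const ‖φ 0‖)).mono'
    (Measurable.aestronglyMeasurable (by fun_prop)) (ae_of_all _ fun z => ?_)
  have h2 := hφ.norm_sub_le (G (x, z)) 0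
  have h3 := norm_sub_norm_le (φ (G (x, z))) (φ 0)
  simp only [sub_zero] at h2
  simp only [Pi.add_apply]
  linarith

/-- Lipschitz tests stay Lipschitz under the transition operator, so the induction over time never
leaves this class. -/
theorem lipschitzWith_transition (hG : IsMeanLipschitz θ G L) {K : NNReal} {φ : E → ℝ}
    (hφ : LipschitzWith K φ) : LipschitzWith (K * L) (transition θ G φ) := by
  have hm := hG.measurable
  intro x x'
  rw [edist_eq_enorm_sub, edist_eq_enorm_sub, transition, transition,
    ← integral_sub (hG.integrable_comp hφ x) (hG.integrable_comp hφ x')]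
  refine (enorm_integral_le_lintegral_enorm _).trans ?_
  calc ∫⁻ z, ‖φ (G (x, z)) - φ (G (x', z))‖ₑ ∂θ
      ≤ ∫⁻ z, K * ‖G (x, z) - G (x', z)‖ₑ ∂θ := by
        refine lintegral_mono fun z => ?_
        simpa [edist_eq_enorm_sub] using hφ (G (x, z)) (G (x', z))
    _ = K * ∫⁻ z, ‖G (x, z) - G (x', z)‖ₑ ∂θ := lintegral_const_mul _ (by fun_prop)
    _ ≤ K * (L * ‖x - x'‖ₑ) := by gcongr; exact hG.lintegral_sub_le x x'
    _ = _ := by push_cast; ring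

variable {ν ν' : ProbabilityMeasure E}

theorem hasFiniteFirstMoment_map (hG : IsMeanLipschitz θ G L) (hν : HasFiniteFirstMoment ν)
    (h : (ν' : Measure E) = ((ν : Measure E).prod θ).map G) : HasFiniteFirstMoment ν' := by
  have hm := hG.measurable
  unfold HasFiniteFirstMoment
  rw [h, lintegral_map (by fun_prop) hm, lintegral_prod _ (by fun_prop)]
  refine (lintegral_mono fun x => hG.lintegral_enorm_le x).trans_lt ?_
  rw [lintegral_add_left measurable_const, lintegral_const_mul _ (by fun_prop)]
  simp only [lintegral_const, measure_univ, mul_one]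
  exact ENNReal.add_lt_top.2 ⟨hG.lintegral_zero, ENNReal.mul_lt_top (by simp) hν⟩

theorem integral_map_eq (hG : IsMeanLipschitz θ G L) (hν : HasFiniteFirstMoment ν)
    (h : (ν' : Measure E) = ((ν : Measure E).prod θ).map G) {K : NNReal} {φ : E → ℝ}
    (hφ : LipschitzWith K φ) :
    ∫ x, φ x ∂(ν' : Measure E) = ∫ x, transition θ G φ x ∂(ν : Measure E) := by
  have hi := hφ.integrable_of_hasFiniteFirstMoment (hG.hasFiniteFirstMoment_map hν h)
  rw [h] at hi ⊢
  rw [integral_map hG.measurable.aemeasurable hi.1]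
  exact integral_prod _ (hi.comp_measurable hG.measurable)

end IsMeanLipschitz

end AverageStep

/-- `n` goes to infinity first with `k` fixed; `k` serves as a truncation level or as the accuracy
of a W₁ bound. -/
theorem ENNReal.tendsto_zero_of_le_double {a : ℕ → ℝ≥0∞} {b : ℕ → ℕ → ℝ≥0∞} {c : ℕ → ℝ≥0∞}
    (h : ∀ k, ∀ᶠ n in atTop, a n ≤ b k n) (hb : ∀ k, Tendsto (b k) atTop (𝓝 (c k)))
    (hc : Tendsto c atTop (𝓝 0)) : Tendsto a atTop (𝓝 0) := by
  rw [ENNReal.tendsto_nhds_zero]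
  intro ε hε
  obtain ⟨k, hk⟩ := (hc.eventually (gt_mem_nhds hε)).exists
  filter_upwards [h k, (hb k).eventually (gt_mem_nhds hk)] with n h1 h2
  exact h1.trans h2.le

theorem enorm_average_sub_le {N : ℕ} (a b : Fin N → ℝ) :
    ‖(N : ℝ)⁻¹ * ∑ i, a i - (N : ℝ)⁻¹ * ∑ i, b i‖ₑ ≤ (N : ℝ≥0∞)⁻¹ * ∑ i, ‖a i - b i‖ₑ := by
  rcases Nat.eq_zero_or_pos N with rfl | hN
  · simp
  rw [← mul_sub, ← Finset.sum_sub_distrib, enorm_mul, enorm_inv (by positivity)]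
  gcongr
  · simp
  · exact enorm_sum_le _ _

/-! ### Lipschitz truncation. -/

section Truncation

variable {E : Type*} [PseudoEMetricSpace E]

theorem LipschitzWith.clamp {K : NNReal} {φ : E → ℝ} (hφ : LipschitzWith K φ) (R : ℝ) :
    LipschitzWith K fun x => max (-R) (min R (φ x)) :=
  (hφ.const_min R).const_max (-R)

theorem LipschitzWith.excess {K : NNReal} {φ : E → ℝ} (hφ : LipschitzWith K φ) (R : ℝ) :
    LipschitzWith K fun x => max (‖φ x‖ - R) 0 := by
  have h1 : LipschitzWith K fun x => ‖φ x‖ := by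
    simpa [Function.comp_def] using lipschitzWith_one_norm.comp hφ
  have h2 : LipschitzWith K fun x => ‖φ x‖ - R := by
    simpa using h1.sub (LipschitzWith.const R)
  exact h2.max_const 0

theorem abs_sub_clamp_le {R : ℝ} (hR : 0 ≤ R) (t : ℝ) :
    |t - max (-R) (min R t)| ≤ max (‖t‖ - R) 0 := by
  rw [Real.norm_eq_abs]
  rcases le_total t R with h1 | h1
  · rw [min_eq_right h1]
    rcases le_total (-R) t with h2 | h2
    · rw [max_eq_right h2]; simp
    · rw [max_eq_left h2]
      refine le_max_of_le_left ?_
      rw [abs_of_nonpos (by linarith), abs_of_nonpos (by linarith)]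
      linarith
  · rw [min_eq_left h1, max_eq_right (by linarith)]
    refine le_max_of_le_left ?_
    rw [abs_of_nonneg (by linarith), abs_of_nonneg (by linarith)]

theorem abs_clamp_le {R : ℝ} (hR : 0 ≤ R) (t : ℝ) : |max (-R) (min R t)| ≤ R :=
  abs_le.2 ⟨le_max_left _ _, max_le (by linarith) (min_le_left _ _)⟩

end Truncation

/-! ### Mean convergence of empirical measures. -/

section EmpiricalTendsto

variable {E : Type*} [NormedAddCommGroup E] [MeasurableSpace E]
  {Ω : ℕ → Type*} [∀ N, MeasurableSpace (Ω N)] {P : ∀ N, Measure (Ω N)}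

/-- Mean convergence of the empirical measures of the families `V N` to `ν`, tested against
Lipschitz functions. -/
def EmpiricalTendsto (P : ∀ N, Measure (Ω N)) (V : ∀ N, Fin N → Ω N → E)
    (ν : ProbabilityMeasure E) : Prop :=
  ∀ (K : NNReal) (φ : E → ℝ), LipschitzWith K φ → Tendsto (fun N : ℕ =>
    ∫⁻ ω, ‖(N : ℝ)⁻¹ * ∑ i, φ (V N i ω) - ∫ x, φ x ∂(ν : Measure E)‖ₑ ∂(P N)) atTop (𝓝 0)

variable [BorelSpace E] {V V' : ∀ N, Fin N → Ω N → E} {ν : ProbabilityMeasure E}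

/-- Averages of a K-Lipschitz test over two families differ by at most K times the mean
displacement. -/
theorem EmpiricalTendsto.of_close (h : EmpiricalTendsto P V ν) (hV : ∀ N i, Measurable (V N i))
    (hclose : Tendsto (fun N : ℕ => ∫⁻ ω, (N : ℝ≥0∞)⁻¹ * ∑ i, ‖V' N i ω - V N i ω‖ₑ ∂(P N))
      atTop (𝓝 0)) : EmpiricalTendsto P V' ν := by
  intro K φ hφ
  have hφm := hφ.continuous.measurable
  have hlim := (ENNReal.Tendsto.const_mul (a := (K : ℝ≥0∞)) hclose (Or.inr (by simp))).add
    (h K φ hφ)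
  rw [mul_zero, zero_add] at hlim
  refine tendsto_of_tendsto_of_tendsto_of_le_of_le tendsto_const_nhds hlim
    (fun _ => zero_le) fun N => ?_
  have hVN := hV N
  calc ∫⁻ ω, ‖(N : ℝ)⁻¹ * ∑ i, φ (V' N i ω) - ∫ x, φ x ∂(ν : Measure E)‖ₑ ∂(P N)
      ≤ ∫⁻ ω, (K * ((N : ℝ≥0∞)⁻¹ * ∑ i, ‖V' N i ω - V N i ω‖ₑ) +
          ‖(N : ℝ)⁻¹ * ∑ i, φ (V N i ω) - ∫ x, φ x ∂(ν : Measure E)‖ₑ) ∂(P N) := by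
        refine lintegral_mono fun ω => ?_
        simp only
        rw [← sub_add_sub_cancel _ ((N : ℝ)⁻¹ * ∑ i, φ (V N i ω))]
        refine (enorm_add_le _ _).trans (add_le_add ?_ le_rfl)
        refine (enorm_average_sub_le _ _).trans ?_
        rw [mul_left_comm, Finset.mul_sum _ _ (K : ℝ≥0∞)]
        gcongr with i
        simpa [edist_eq_enorm_sub] using hφ (V' N i ω) (V N i ω)
    _ = _ := by
        rw [lintegral_add_right _ (by fun_prop), lintegral_const_mul' _ _ (by simp)]

end EmpiricalTendsto

/-! ### Propagation of convergence through one time step. -/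

section Step

variable {E E' : Type*} [NormedAddCommGroup E] [MeasurableSpace E] [BorelSpace E]
  [SecondCountableTopology E] [MeasurableSpace E'] {θ : Measure E'} [IsProbabilityMeasure θ]
  {G : E × E' → E} {L : NNReal}

/-- Mean deviation of an average of one-step images from the average of the transition
operator, with truncation at level `R`. -/
theorem IsMeanLipschitz.lintegral_enorm_average_sub_transition_le (hG : IsMeanLipschitz θ G L)
    {K : NNReal} {φ : E → ℝ} (hφ : LipschitzWith K φ) {R : ℝ} (hR : 0 ≤ R) {N : ℕ} (hN : 0 < N)
    (x : Fin N → E) :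
    ∫⁻ u, ‖(N : ℝ)⁻¹ * ∑ i, φ (G (x i, u i)) - (N : ℝ)⁻¹ * ∑ i, transition θ G φ (x i)‖ₑ
      ∂(Measure.pi fun _ : Fin N => θ) ≤
    ENNReal.ofReal (R / √N) + 2 * ENNReal.ofReal ((N : ℝ)⁻¹ *
      ∑ i, transition θ G (fun y => max (‖φ y‖ - R) 0) (x i)) := by
  set κ := Measure.pi fun _ : Fin N => θ with hκ
  set φR : E → ℝ := fun y => max (-R) (min R (φ y)) with hφR
  set ψ : E → ℝ := fun y => max (‖φ y‖ - R) 0 with hψ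
  have hm := hG.measurable
  have hφRl : LipschitzWith K φR := hφ.clamp R
  have hψl : LipschitzWith K ψ := hφ.excess R
  have hφRm := hφRl.continuous.measurable
  have hψm := hψl.continuous.measurable
  have hψ0 : ∀ y, 0 ≤ ψ y := fun y => le_max_right _ _
  have hdiff : ∀ y, |φ y - φR y| ≤ ψ y := fun y => abs_sub_clamp_le hR (φ y)
  have hNinv : (0 : ℝ) ≤ (N : ℝ)⁻¹ := by positivity
  have htrans : ∀ y, |transition θ G φ y - transition θ G φR y| ≤ transition θ G ψ y := by
    intro y
    rw [transition, transition, ← integral_sub (hG.integrable_comp hφ y)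
      (hG.integrable_comp hφRl y)]
    refine (abs_integral_le_integral_abs).trans ?_
    exact integral_mono ((hG.integrable_comp hφ y).sub (hG.integrable_comp hφRl y)).abs
      (hG.integrable_comp hψl y) fun z => hdiff _
  have htrans0 : ∀ y, 0 ≤ transition θ G ψ y := fun y => integral_nonneg fun z => hψ0 _
  -- Averaged over the noise, the excess at the images equals the excess under the transition
  -- operator; both occur in the bound, hence the factor 2.
  have hmid : ∫⁻ u, ENNReal.ofReal ((N : ℝ)⁻¹ * ∑ i, ψ (G (x i, u i))) ∂κ =
      ENNReal.ofReal ((N : ℝ)⁻¹ * ∑ i, transition θ G ψ (x i)) := by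
    have hmp : ∀ i, MeasurePreserving (fun u : Fin N → E' => u i) κ θ :=
      fun i => measurePreserving_eval _ i
    have hint : ∀ i, Integrable (fun u : Fin N → E' => ψ (G (x i, u i))) κ := fun i =>
      (hmp i).integrable_comp_of_integrable (hG.integrable_comp hψl (x i))
    rw [← ofReal_integral_eq_lintegral_ofReal
      ((integrable_finsetSum _ fun i _ => hint i).const_mul _)
      (ae_of_all _ fun u => mul_nonneg hNinv (Finset.sum_nonneg fun i _ => hψ0 _)),
      integral_const_mul, integral_finsetSum _ fun i _ => hint i]
    congr 2
    refine Finset.sum_congr rfl fun i _ => ?_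
    rw [transition, ← (hmp i).map_eq, integral_map (hmp i).measurable.aemeasurable]
    exact Measurable.aestronglyMeasurable (by fun_prop)
  calc ∫⁻ u, ‖(N : ℝ)⁻¹ * ∑ i, φ (G (x i, u i)) - (N : ℝ)⁻¹ * ∑ i, transition θ G φ (x i)‖ₑ ∂κ
      ≤ ∫⁻ u, (‖(N : ℝ)⁻¹ * ∑ i, φR (G (x i, u i)) -
            (N : ℝ)⁻¹ * ∑ i, transition θ G φR (x i)‖ₑ +
          (ENNReal.ofReal ((N : ℝ)⁻¹ * ∑ i, ψ (G (x i, u i))) +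
            ENNReal.ofReal ((N : ℝ)⁻¹ * ∑ i, transition θ G ψ (x i)))) ∂κ := by
        refine lintegral_mono fun u => ?_
        simp only
        rw [← ofReal_norm, ← ofReal_norm, ← ENNReal.ofReal_add, ← ENNReal.ofReal_add]
        rotate_left
        · exact norm_nonneg _
        · exact add_nonneg (mul_nonneg hNinv (Finset.sum_nonneg fun i _ => hψ0 _))
            (mul_nonneg hNinv (Finset.sum_nonneg fun i _ => htrans0 _))
        · exact mul_nonneg hNinv (Finset.sum_nonneg fun i _ => hψ0 _)
        · exact mul_nonneg hNinv (Finset.sum_nonneg fun i _ => htrans0 _)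
        refine ENNReal.ofReal_le_ofReal ?_
        have e1 : |(N : ℝ)⁻¹ * ∑ i, φ (G (x i, u i)) - (N : ℝ)⁻¹ * ∑ i, φR (G (x i, u i))| ≤
            (N : ℝ)⁻¹ * ∑ i, ψ (G (x i, u i)) := by
          rw [← mul_sub, ← Finset.sum_sub_distrib, abs_mul, abs_of_nonneg hNinv]
          gcongr
          exact (Finset.abs_sum_le_sum_abs _ _).trans (Finset.sum_le_sum fun i _ => hdiff _)
        have e2 : |(N : ℝ)⁻¹ * ∑ i, transition θ G φ (x i) -
            (N : ℝ)⁻¹ * ∑ i, transition θ G φR (x i)| ≤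
            (N : ℝ)⁻¹ * ∑ i, transition θ G ψ (x i) := by
          rw [← mul_sub, ← Finset.sum_sub_distrib, abs_mul, abs_of_nonneg hNinv]
          gcongr
          exact (Finset.abs_sum_le_sum_abs _ _).trans (Finset.sum_le_sum fun i _ => htrans _)
        rw [Real.norm_eq_abs, Real.norm_eq_abs]
        rw [abs_le] at e1 e2 ⊢
        have e3 := le_abs_self ((N : ℝ)⁻¹ * ∑ i, φR (G (x i, u i)) -
            (N : ℝ)⁻¹ * ∑ i, transition θ G φR (x i))
        have e4 := neg_abs_le ((N : ℝ)⁻¹ * ∑ i, φR (G (x i, u i)) -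
            (N : ℝ)⁻¹ * ∑ i, transition θ G φR (x i))
        constructor <;> linarith [e1.1, e1.2, e2.1, e2.2]
    _ = ∫⁻ u, ‖(N : ℝ)⁻¹ * ∑ i, φR (G (x i, u i)) -
            (N : ℝ)⁻¹ * ∑ i, transition θ G φR (x i)‖ₑ ∂κ +
          (ENNReal.ofReal ((N : ℝ)⁻¹ * ∑ i, transition θ G ψ (x i)) +
            ENNReal.ofReal ((N : ℝ)⁻¹ * ∑ i, transition θ G ψ (x i))) := by
        rw [lintegral_add_left (by fun_prop), lintegral_add_right _ measurable_const, hmid]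
        simp
    _ ≤ _ := by
        rw [two_mul]
        gcongr
        exact lintegral_enorm_average_sub_le (g := fun p => φR (G p)) (by fun_prop) hR
          (fun p => abs_clamp_le hR _) hN x

variable {Ω : ℕ → Type*} [∀ N, MeasurableSpace (Ω N)] {P : ∀ N, Measure (Ω N)}

variable {V V' : ∀ N, Fin N → Ω N → E} {U : ∀ N, Fin N → Ω N → E'} {ν ν' : ProbabilityMeasure E}

variable [∀ N, IsProbabilityMeasure (P N)]

/-- Law of large numbers along one step of the random map `G`. -/
theorem EmpiricalTendsto.image (h : EmpiricalTendsto P V ν) (hν : HasFiniteFirstMoment ν)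
    (hV : ∀ N i, Measurable (V N i)) (hU : ∀ N i, Measurable (U N i))
    (hlaw : ∀ N, 0 < N → (P N).map (fun ω => ((fun i => V N i ω), fun i => U N i ω)) =
      ((P N).map fun ω i => V N i ω).prod (Measure.pi fun _ => θ))
    (hG : IsMeanLipschitz θ G L) (hν' : (ν' : Measure E) = ((ν : Measure E).prod θ).map G) :
    EmpiricalTendsto P (fun N i ω => G (V N i ω, U N i ω)) ν' := by
  intro K φ hφ
  have hm := hG.measurable
  have hφm := hφ.continuous.measurable
  have hTl := hG.lipschitzWith_transition hφ
  have hTm := hTl.continuous.measurable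
  have hν'1 := hG.hasFiniteFirstMoment_map hν hν'
  have hdev : Tendsto (fun N : ℕ => ∫⁻ ω, ‖(N : ℝ)⁻¹ * ∑ i, φ (G (V N i ω, U N i ω)) -
      (N : ℝ)⁻¹ * ∑ i, transition θ G φ (V N i ω)‖ₑ ∂(P N)) atTop (𝓝 0) := by
    let ψ : ℕ → E → ℝ := fun k y => max (‖φ y‖ - k) 0
    have hψl : ∀ k, LipschitzWith K (ψ k) := fun k => hφ.excess k
    have hTψl := fun k => hG.lipschitzWith_transition (hψl k)
    have hTψm := fun k => (hTψl k).continuous.measurable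
    let t : ℕ → ℕ → ℝ≥0∞ := fun k N => ∫⁻ ω, ‖(N : ℝ)⁻¹ * ∑ i, transition θ G (ψ k) (V N i ω) -
      ∫ x, transition θ G (ψ k) x ∂(ν : Measure E)‖ₑ ∂(P N)
    -- Truncation at level `k`: as N → ∞ the terms k/√N and `t k N` vanish, the latter because the
    -- transition of the excess is a Lipschitz test. The excess left under ν' vanishes as k → ∞.
    refine ENNReal.tendsto_zero_of_le_double
      (b := fun k N => ENNReal.ofReal (k / √N) +
        2 * (ENNReal.ofReal (∫ x, ψ k x ∂(ν' : Measure E)) + t k N))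
      (c := fun k => ENNReal.ofReal 0 +
        2 * (ENNReal.ofReal (∫ x, ψ k x ∂(ν' : Measure E)) + 0)) (fun k => ?_) (fun k => ?_) ?_
    · filter_upwards [eventually_gt_atTop 0] with N hN
      have hVm : Measurable fun ω i => V N i ω := measurable_pi_iff.2 (hV N)
      have hUm : Measurable fun ω i => U N i ω := measurable_pi_iff.2 (hU N)
      let Φ : (Fin N → E) × (Fin N → E') → ℝ≥0∞ := fun p =>
        ‖(N : ℝ)⁻¹ * ∑ i, φ (G (p.1 i, p.2 i)) - (N : ℝ)⁻¹ * ∑ i, transition θ G φ (p.1 i)‖ₑ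
      have hΦ : Measurable Φ := by fun_prop
      -- By independence the noise may be integrated first, with the states held fixed.
      have e1 : ∫⁻ ω, ‖(N : ℝ)⁻¹ * ∑ i, φ (G (V N i ω, U N i ω)) -
          (N : ℝ)⁻¹ * ∑ i, transition θ G φ (V N i ω)‖ₑ ∂(P N) =
          ∫⁻ x, ∫⁻ u, Φ (x, u) ∂(Measure.pi fun _ => θ) ∂((P N).map fun ω i => V N i ω) := by
        rw [← lintegral_prod _ hΦ.aemeasurable, ← hlaw N hN,
          lintegral_map hΦ (hVm.prodMk hUm)]
      rw [e1]
      refine (lintegral_mono fun x => hG.lintegral_enorm_average_sub_transition_le hφ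
        (Nat.cast_nonneg k) hN x).trans ?_
      rw [lintegral_map (by fun_prop) hVm, lintegral_add_left measurable_const,
        lintegral_const_mul' _ _ (by simp)]
      simp only [lintegral_const, measure_univ, mul_one]
      gcongr
      have e2 : ENNReal.ofReal (∫ x, ψ k x ∂(ν' : Measure E)) + t k N =
          ∫⁻ ω, (ENNReal.ofReal (∫ x, ψ k x ∂(ν' : Measure E)) +
            ‖(N : ℝ)⁻¹ * ∑ i, transition θ G (ψ k) (V N i ω) -
            ∫ x, transition θ G (ψ k) x ∂(ν : Measure E)‖ₑ) ∂(P N) := by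
        rw [lintegral_add_left measurable_const]
        simp [t]
      rw [e2]
      refine lintegral_mono fun ω => ?_
      have hnn : 0 ≤ ∫ x, ψ k x ∂(ν' : Measure E) := integral_nonneg fun x => le_max_right _ _
      simp only
      rw [← ofReal_norm, ← ENNReal.ofReal_add hnn (norm_nonneg _),
        hG.integral_map_eq hν hν' (hψl k)]
      refine ENNReal.ofReal_le_ofReal ?_
      rw [Real.norm_eq_abs]
      have := le_abs_self ((N : ℝ)⁻¹ * ∑ i, transition θ G (ψ k) (V N i ω) -
            ∫ x, transition θ G (ψ k) x ∂(ν : Measure E))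
      linarith
    · have h1 : Tendsto (fun N : ℕ => (k : ℝ) / √N) atTop (𝓝 0) :=
        tendsto_const_nhds.div_atTop
          ((Real.tendsto_sqrt_atTop).comp tendsto_natCast_atTop_atTop)
      exact (ENNReal.tendsto_ofReal h1).add (ENNReal.Tendsto.const_mul
        (tendsto_const_nhds.add (h _ _ (hTψl k))) (Or.inr (by simp)))
    · have h1 := tendsto_integral_norm_sub_max (hφ.integrable_of_hasFiniteFirstMoment hν'1)
      have h2 := ENNReal.Tendsto.const_mul (a := 2) (ENNReal.tendsto_ofReal h1)
        (Or.inr (by simp))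
      simpa [ψ] using h2
  have hlim := hdev.add (h _ _ hTl)
  rw [zero_add] at hlim
  refine tendsto_of_tendsto_of_tendsto_of_le_of_le tendsto_const_nhds hlim
    (fun _ => zero_le) fun N => ?_
  have hVN := hV N
  have hUN := hU N
  simp only
  rw [← lintegral_add_right _ (by fun_prop)]
  refine lintegral_mono fun ω => ?_
  simp only
  rw [hG.integral_map_eq hν hν' hφ,
    ← sub_add_sub_cancel _ ((N : ℝ)⁻¹ * ∑ i, transition θ G φ (V N i ω))]
  exact enorm_add_le _ _

/-- Convergence of the empirical measures controls their Wasserstein distance to the limit by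
measurable functions of small mean. -/
theorem EmpiricalTendsto.exists_W1_bound (h : EmpiricalTendsto P V ν)
    (hν : HasFiniteFirstMoment ν) (hV : ∀ N i, Measurable (V N i)) {r : ℝ} (hr : 0 < r) :
    ∃ B : ∀ N, (Fin N → E) → ℝ≥0∞, (∀ N, Measurable (B N)) ∧
      (∀ (N : ℕ) [NeZero N] (x : Fin N → E), W1 (empiricalMeasure x) ν ≤ B N x) ∧
      Tendsto (fun N => ∫⁻ ω, B N (fun i => V N i ω) ∂(P N)) atTop (𝓝 (ENNReal.ofReal r)) := by
  obtain ⟨ι, _, φ, C, hφ, hC⟩ := exists_lipschitz_test_family hν hr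
  choose K hK using hφ
  have hφm := fun j => (hK j).continuous.measurable
  -- This majorant is measurable in the points, so measurability of `W1` in the sample is never
  -- needed.
  refine ⟨fun N x => ENNReal.ofReal r + C * ∑ j, ‖(N : ℝ)⁻¹ * ∑ i, φ j (x i) -
    ∫ x, φ j x ∂(ν : Measure E)‖ₑ, fun N => by fun_prop, fun N _ x => ?_, ?_⟩
  · refine (hC _ (hasFiniteFirstMoment_empiricalMeasure x)).trans_eq ?_
    simp_rw [integral_empiricalMeasure x (hφm _)]
  · have h1 := tendsto_finsetSum Finset.univ fun j (_ : j ∈ Finset.univ) => h (K j) (φ j) (hK j)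
    have h2 := (ENNReal.Tendsto.const_mul (a := (C : ℝ≥0∞)) h1 (Or.inr (by simp))).const_add
      (ENNReal.ofReal r)
    simp only [Finset.sum_const_zero, mul_zero, add_zero] at h2
    refine h2.congr fun N => ?_
    have hVN := hV N
    rw [lintegral_add_left measurable_const, lintegral_const_mul' _ _ (by simp),
      lintegral_finsetSum _ fun j _ => by fun_prop]
    simp

/-- One step of a recursion whose mean-field interaction is Lipschitz for `W1`. -/
theorem EmpiricalTendsto.step (h : EmpiricalTendsto P V ν) (hν : HasFiniteFirstMoment ν)
    (hV : ∀ N i, Measurable (V N i)) (hU : ∀ N i, Measurable (U N i))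
    (hlaw : ∀ N, 0 < N → (P N).map (fun ω => ((fun i => V N i ω), fun i => U N i ω)) =
      ((P N).map fun ω i => V N i ω).prod (Measure.pi fun _ => θ))
    (hG : IsMeanLipschitz θ G L) (hν' : (ν' : Measure E) = ((ν : Measure E).prod θ).map G)
    {D : E' → ℝ≥0∞} (hD : AEMeasurable D θ) (hDint : ∫⁻ z, D z ∂θ ≠ ∞)
    (hclose : ∀ (N : ℕ) [NeZero N] i, ∀ᵐ ω ∂(P N), ‖V' N i ω - G (V N i ω, U N i ω)‖ₑ ≤
      D (U N i ω) * W1 (empiricalMeasure fun j => V N j ω) ν) :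
    EmpiricalTendsto P V' ν' := by
  have hm := hG.measurable
  refine (h.image hν hV hU hlaw hG hν').of_close
    (fun N i => hm.comp ((hV N i).prodMk (hU N i))) ?_
  choose B hBm hBW hBlim using fun k : ℕ =>
    h.exists_W1_bound hν hV (r := 1 / ((k : ℝ) + 1)) Nat.one_div_pos_of_nat
  refine ENNReal.tendsto_zero_of_le_double
    (b := fun k N => (∫⁻ z, D z ∂θ) * ∫⁻ ω, B k N (fun i => V N i ω) ∂(P N))
    (c := fun k => (∫⁻ z, D z ∂θ) * ENNReal.ofReal (1 / ((k : ℝ) + 1))) (fun k => ?_)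
    (fun k => ENNReal.Tendsto.const_mul (hBlim k) (Or.inr hDint)) ?_
  · filter_upwards [eventually_gt_atTop 0] with N hN
    have : NeZero N := ⟨hN.ne'⟩
    have hVm : Measurable fun ω i => V N i ω := measurable_pi_iff.2 (hV N)
    have hUm : Measurable fun ω i => U N i ω := measurable_pi_iff.2 (hU N)
    have hmp : ∀ i, MeasurePreserving (fun u : Fin N → E' => u i) (Measure.pi fun _ => θ) θ :=
      fun i => measurePreserving_eval _ i
    have hDi : ∀ i, AEMeasurable (fun u : Fin N → E' => D (u i)) (Measure.pi fun _ => θ) :=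
      fun i => hD.comp_quasiMeasurePreserving (hmp i).quasiMeasurePreserving
    have hjoint : ∀ i, AEMeasurable (fun p : (Fin N → E) × (Fin N → E') => B k N p.1 * D (p.2 i))
        ((P N).map (fun ω => ((fun i => V N i ω), fun i => U N i ω))) := fun i => by
      rw [hlaw N hN]
      exact ((hBm k N).comp measurable_fst).aemeasurable.mul
        ((hDi i).comp_quasiMeasurePreserving Measure.quasiMeasurePreserving_snd)
    -- Independence splits the mean. As `D` is only almost everywhere measurable, the splitting is
    -- done on the product law.
    have hprod : ∀ i, ∫⁻ ω, B k N (fun i => V N i ω) * D (U N i ω) ∂(P N) =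
        (∫⁻ z, D z ∂θ) * ∫⁻ ω, B k N (fun i => V N i ω) ∂(P N) := by
      intro i
      have e1 := lintegral_map' (hjoint i) (hVm.prodMk hUm).aemeasurable
      rw [← e1, hlaw N hN, lintegral_prod_mul (hBm k N).aemeasurable (hDi i),
        lintegral_map (hBm k N) hVm, mul_comm]
      congr 1
      conv_rhs => rw [← (hmp i).map_eq]
      rw [lintegral_map' _ (hmp i).measurable.aemeasurable]
      rwa [(hmp i).map_eq]
    have hall : ∀ᵐ ω ∂(P N), ∀ i, ‖V' N i ω - G (V N i ω, U N i ω)‖ₑ ≤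
        B k N (fun i => V N i ω) * D (U N i ω) := by
      rw [ae_all_iff]
      intro i
      filter_upwards [hclose N i] with ω hω
      rw [mul_comm]
      exact hω.trans (by gcongr; exact hBW k N _)
    calc ∫⁻ ω, (N : ℝ≥0∞)⁻¹ * ∑ i, ‖V' N i ω - G (V N i ω, U N i ω)‖ₑ ∂(P N)
        ≤ ∫⁻ ω, (N : ℝ≥0∞)⁻¹ * ∑ i, B k N (fun i => V N i ω) * D (U N i ω) ∂(P N) := by
          refine lintegral_mono_ae ?_
          filter_upwards [hall] with ω hω
          gcongr with i
          exact hω i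
      _ = (N : ℝ≥0∞)⁻¹ * ∑ _i : Fin N,
            (∫⁻ z, D z ∂θ) * ∫⁻ ω, B k N (fun i => V N i ω) ∂(P N) := by
          rw [lintegral_const_mul' _ _ (by simpa using hN.ne'), lintegral_finsetSum'
            (f := fun i ω => B k N (fun i => V N i ω) * D (U N i ω)) _ fun i _ =>
              (hjoint i).comp_measurable (hVm.prodMk hUm)]
          simp_rw [hprod]
      _ ≤ _ := by
          rw [Finset.sum_const, Finset.card_univ, Fintype.card_fin, nsmul_eq_mul, ← mul_assoc,
            ENNReal.inv_mul_cancel (by simpa using hN.ne') (by simp), one_mul]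
  · have h1 := ENNReal.Tendsto.const_mul (a := ∫⁻ z, D z ∂θ)
      (ENNReal.tendsto_ofReal (tendsto_one_div_add_atTop_nhds_zero_nat (𝕜 := ℝ))) (Or.inr hDint)
    simpa using h1

end Step

/-! ### Sampling with and without replacement. -/

section Sampling

/-- Moving to the finite index set turns integrals into finite sums, without asking for measurable
singletons in `E`. -/
theorem pi_empiricalMeasure {E : Type*} [MeasurableSpace E] {N : ℕ} [NeZero N] (x : Fin N → E)
    (k : ℕ) :
    (Measure.pi fun _ : Fin k => (empiricalMeasure x : Measure E)) =
      (Measure.pi fun _ : Fin k => (empiricalMeasure (id : Fin N → Fin N) : Measure (Fin N))).map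
        fun σ i => x (σ i) := by
  have hx : Measurable x := measurable_of_finite x
  have hmap : (empiricalMeasure x : Measure E) =
      (empiricalMeasure (id : Fin N → Fin N) : Measure (Fin N)).map x := by
    rw [coe_empiricalMeasure, coe_empiricalMeasure, Measure.map_smul]
    congr 1
    ext s hs
    rw [Measure.map_apply hx hs]
    simp only [Measure.coe_finsetSum, Finset.sum_apply]
    refine Finset.sum_congr rfl fun i _ => ?_
    rw [Measure.dirac_apply' _ hs, Measure.dirac_apply' _ (hx hs)]
    rfl
  rw [Measure.pi_map_pi (f := fun _ => x) fun _ => hx.aemeasurable, hmap]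

/-- Integration against the `k`-fold power of an empirical measure is averaging over samples with
replacement. -/
theorem integral_pi_empiricalMeasure {E : Type*} [MeasurableSpace E] {N : ℕ} [NeZero N]
    (x : Fin N → E) {k : ℕ} {Φ : (Fin k → E) → ℝ} (hΦ : Measurable Φ) :
    ∫ y, Φ y ∂(Measure.pi fun _ : Fin k => (empiricalMeasure x : Measure E)) =
      ((N : ℝ) ^ k)⁻¹ * ∑ σ : Fin k → Fin N, Φ fun i => x (σ i) := by
  have hx : Measurable fun (σ : Fin k → Fin N) i => x (σ i) := measurable_of_finite _
  rw [pi_empiricalMeasure, integral_map hx.aemeasurable hΦ.aestronglyMeasurable,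
    integral_fintype (Integrable.of_finite), Finset.mul_sum]
  refine Finset.sum_congr rfl fun σ _ => ?_
  rw [smul_eq_mul, measureReal_def, Measure.pi_singleton]
  congr 1
  have : ∀ i, (empiricalMeasure (id : Fin N → Fin N) : Measure (Fin N)) {i} = (N : ℝ≥0∞)⁻¹ := by
    intro i
    rw [coe_empiricalMeasure]
    simp [Set.indicator_apply]
  simp [this]

/-- Under exchangeability, sampling with and without replacement differ by the probability of a
repetition. -/
theorem Exchangeable.abs_integral_sub_average_le {Ω E : Type*} [MeasurableSpace Ω]
    [MeasurableSpace E] {P : Measure Ω} [IsProbabilityMeasure P] {k j : ℕ}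
    {X : Fin (k + j) → Ω → E} (hX : ∀ i, Measurable (X i)) (hex : Exchangeable X P)
    {Φ : (Fin k → E) → ℝ} (hΦ : Measurable Φ) {C : ℝ} (hC : ∀ y, |Φ y| ≤ C) (hpos : 0 < k + j) :
    |∫ ω, Φ (fun i => X (Fin.castAdd j i) ω) ∂P -
      ∫ ω, (((k + j : ℕ) : ℝ) ^ k)⁻¹ * ∑ σ : Fin k → Fin (k + j), Φ (fun i => X (σ i) ω) ∂P| ≤
      2 * C * (1 - (k + j).descFactorial k / ((k + j : ℕ) : ℝ) ^ k) := by
  classical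
  set m : (Fin k → Fin (k + j)) → ℝ := fun σ => ∫ ω, Φ (fun i => X (σ i) ω) ∂P with hm
  set m₀ : ℝ := ∫ ω, Φ (fun i => X (Fin.castAdd j i) ω) ∂P with hm₀
  have hmeas : ∀ σ : Fin k → Fin (k + j), Measurable fun ω => Φ fun i => X (σ i) ω := fun σ =>
    hΦ.comp (measurable_pi_iff.2 fun i => hX (σ i))
  have hint : ∀ σ : Fin k → Fin (k + j), Integrable (fun ω => Φ fun i => X (σ i) ω) P := fun σ =>
    (integrable_const C).mono' (hmeas σ).aestronglyMeasurable (ae_of_all _ fun ω => hC _)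
  have hbd : ∀ σ, |m σ| ≤ C := fun σ => by
    have := norm_integral_le_of_norm_le_const (μ := P) (f := fun ω => Φ fun i => X (σ i) ω)
      (C := C) (ae_of_all _ fun ω => hC _)
    simpa using this
  have hbd₀ : |m₀| ≤ C := hbd (Fin.castAdd j)
  have hinj : ∀ σ, Function.Injective σ → m σ = m₀ := by
    intro σ hσ
    -- An injective choice of indices extends to a permutation, to which exchangeability applies.
    obtain ⟨π, hπ⟩ := Equiv.Perm.exists_extending_pair (Fin.castAdd j) σ
      (Fin.castAdd_injective k j) hσ
    have hev : Measurable fun y : Fin (k + j) → E => Φ fun i => y (Fin.castAdd j i) :=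
      hΦ.comp (by fun_prop)
    have h1 := integral_map (μ := P) (measurable_pi_iff.2 hX).aemeasurable
      hev.aestronglyMeasurable
    have h2 := integral_map (μ := P)
      (measurable_pi_iff.2 fun i => hX (π i) : Measurable fun ω i => X (π i) ω).aemeasurable
      hev.aestronglyMeasurable
    rw [← hex π] at h2
    simp only [hπ] at h2
    rw [hm, hm₀]
    simp only
    rw [← h2]
    exact h1
  have hNpos : (0 : ℝ) < ((k + j : ℕ) : ℝ) ^ k := by positivity
  have hcard : ((Finset.univ.filter fun σ : Fin k → Fin (k + j) =>
      ¬ Function.Injective σ).card : ℝ) =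
      ((k + j : ℕ) : ℝ) ^ k - (k + j).descFactorial k := by
    have h1 := Finset.card_filter_add_card_filter_not (s := Finset.univ)
      fun σ : Fin k → Fin (k + j) => Function.Injective σ
    have h2 : (Finset.univ.filter fun σ : Fin k → Fin (k + j) => Function.Injective σ).card =
        (k + j).descFactorial k := by
      rw [← Fintype.card_subtype, Fintype.card_congr
        (Equiv.subtypeInjectiveEquivEmbedding (Fin k) (Fin (k + j))), Fintype.card_embedding_eq]
      simp
    rw [h2] at h1
    simp only [Finset.card_univ, Fintype.card_pi, Fintype.card_fin, Finset.prod_const] at h1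
    have h3 := congrArg (Nat.cast (R := ℝ)) h1
    push_cast at h3 ⊢
    linarith
  have hdiff : m₀ - ∫ ω, (((k + j : ℕ) : ℝ) ^ k)⁻¹ *
      ∑ σ : Fin k → Fin (k + j), Φ (fun i => X (σ i) ω) ∂P =
      (((k + j : ℕ) : ℝ) ^ k)⁻¹ * ∑ σ : Fin k → Fin (k + j), (m₀ - m σ) := by
    rw [integral_const_mul, integral_finsetSum _ fun σ _ => hint σ, Finset.sum_sub_distrib,
      mul_sub]
    congr 1
    simp only [Finset.sum_const, Finset.card_univ, Fintype.card_pi, Fintype.card_fin,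
      Finset.prod_const, nsmul_eq_mul]
    push_cast at hNpos ⊢
    field_simp
  rw [hdiff, abs_mul, abs_of_pos (inv_pos.2 hNpos)]
  -- Injective samples contribute nothing and every other sample at most 2C.
  calc (((k + j : ℕ) : ℝ) ^ k)⁻¹ * |∑ σ : Fin k → Fin (k + j), (m₀ - m σ)|
      ≤ (((k + j : ℕ) : ℝ) ^ k)⁻¹ * ∑ σ : Fin k → Fin (k + j),
          (if ¬ Function.Injective σ then 2 * C else 0) := by
        gcongr
        refine (Finset.abs_sum_le_sum_abs _ _).trans (Finset.sum_le_sum fun σ _ => ?_)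
        split_ifs with h
        · simp [hinj σ h]
        · refine (abs_sub _ _).trans ?_
          linarith [hbd σ]
    _ = 2 * C * (1 - (k + j).descFactorial k / ((k + j : ℕ) : ℝ) ^ k) := by
        rw [← Finset.sum_filter, Finset.sum_const, nsmul_eq_mul, hcard]
        field_simp

/-- With N = k + j, each of the k factors of the descending factorial is at least j + 1, so the
quotient lies between ((j + 1)/N)^k and 1. -/
theorem tendsto_one_sub_descFactorial_div_pow (k : ℕ) :
    Tendsto (fun j : ℕ => 1 - ((k + j).descFactorial k : ℝ) / ((k + j : ℕ) : ℝ) ^ k) atTop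
      (𝓝 0) := by
  have hratio : Tendsto (fun j : ℕ => ((j : ℝ) + 1) / ((k + j : ℕ) : ℝ)) atTop (𝓝 1) := by
    have h1 : Tendsto (fun j : ℕ => 1 - ((k : ℝ) - 1) / ((k + j : ℕ) : ℝ)) atTop (𝓝 (1 - 0)) := by
      refine tendsto_const_nhds.sub (tendsto_const_nhds.div_atTop ?_)
      exact tendsto_natCast_atTop_atTop.comp
        (tendsto_atTop_mono (fun j => Nat.le_add_left j k) tendsto_id)
    rw [sub_zero] at h1
    refine h1.congr' ?_
    filter_upwards [eventually_gt_atTop 0] with j hj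
    have : (0 : ℝ) < ((k + j : ℕ) : ℝ) := by
      have : 0 < k + j := by omega
      exact_mod_cast this
    rw [eq_div_iff this.ne', sub_mul, div_mul_cancel₀ _ this.ne']
    push_cast
    ring
  have hpow := (tendsto_const_nhds (x := (1 : ℝ))).sub (hratio.pow k)
  rw [one_pow, sub_self] at hpow
  refine tendsto_of_tendsto_of_tendsto_of_le_of_le tendsto_const_nhds hpow (fun j => ?_) fun j => ?_
  · rw [sub_nonneg]
    refine div_le_one_of_le₀ ?_ (by positivity)
    rw [← Nat.cast_pow]
    exact Nat.cast_le.2 (Nat.descFactorial_le_pow (k + j) k)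
  · simp only
    rw [div_pow]
    gcongr
    have := Nat.pow_sub_le_descFactorial (k + j) k
    rw [show k + j + 1 - k = j + 1 by omega] at this
    exact_mod_cast this

end Sampling

/-! ### From empirical measures to asymptotic independence. -/

section WeakConvergence

variable {E : Type*} [NormedAddCommGroup E] [MeasurableSpace E] [BorelSpace E]
  [SecondCountableTopology E]

/-- Integrals of a bounded Lipschitz function against `k`-fold powers are `W1`-Lipschitz. -/
theorem enorm_integral_pi_sub_le (μ ν : ProbabilityMeasure E) {k : ℕ} {L : NNReal}
    {Φ : (Fin k → E) → ℝ} (hΦ : LipschitzWith L Φ) {C : ℝ} (hC : ∀ y, |Φ y| ≤ C) :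
    ‖∫ y, Φ y ∂(Measure.pi fun _ : Fin k => (μ : Measure E)) -
      ∫ y, Φ y ∂(Measure.pi fun _ : Fin k => (ν : Measure E))‖ₑ ≤
      ((L * k : NNReal) : ℝ≥0∞) * W1 μ ν := by
  refine le_mul_W1 _ fun γ h₁ h₂ => ?_
  have hγ : IsProbabilityMeasure γ := by
    refine ⟨?_⟩
    have h := congrArg (fun m : Measure E => m Set.univ) h₁
    simpa [Measure.map_apply measurable_fst] using h
  have hΦm := hΦ.continuous.measurable
  -- Independent copies of γ couple the two powers.
  have e₁ : (Measure.pi fun _ : Fin k => (μ : Measure E)) =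
      (Measure.pi fun _ : Fin k => γ).map fun p i => (p i).1 := by
    rw [Measure.pi_map_pi (f := fun _ => Prod.fst) fun _ => measurable_fst.aemeasurable]
    simp [h₁]
  have e₂ : (Measure.pi fun _ : Fin k => (ν : Measure E)) =
      (Measure.pi fun _ : Fin k => γ).map fun p i => (p i).2 := by
    rw [Measure.pi_map_pi (f := fun _ => Prod.snd) fun _ => measurable_snd.aemeasurable]
    simp [h₂]
  have hint : ∀ g : (Fin k → E × E) → (Fin k → E), Measurable g →
      Integrable (fun p => Φ (g p)) (Measure.pi fun _ : Fin k => γ) := fun g hg =>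
    (integrable_const C).mono' (hΦm.comp hg).aestronglyMeasurable (ae_of_all _ fun p => hC _)
  rw [e₁, e₂, integral_map (Measurable.aemeasurable (by fun_prop)) hΦm.aestronglyMeasurable,
    integral_map (Measurable.aemeasurable (by fun_prop)) hΦm.aestronglyMeasurable,
    ← integral_sub (hint _ (by fun_prop)) (hint _ (by fun_prop))]
  refine (enorm_integral_le_lintegral_enorm _).trans ?_
  calc ∫⁻ p, ‖Φ (fun i => (p i).1) - Φ (fun i => (p i).2)‖ₑ ∂(Measure.pi fun _ : Fin k => γ)
      ≤ ∫⁻ p, L * ∑ i, ‖(p i).1 - (p i).2‖ₑ ∂(Measure.pi fun _ : Fin k => γ) := by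
        refine lintegral_mono fun p => ?_
        have h := hΦ (fun i => (p i).1) (fun i => (p i).2)
        rw [edist_eq_enorm_sub] at h
        refine h.trans ?_
        gcongr
        -- The sup distance is at most the sum of the coordinate distances; this produces the factor
        -- k.
        rw [edist_pi_le_iff]
        intro i
        rw [edist_eq_enorm_sub]
        exact Finset.single_le_sum (f := fun i => ‖(p i).1 - (p i).2‖ₑ) (fun _ _ => zero_le)
          (Finset.mem_univ i)
    _ = L * ∑ _i : Fin k, ∫⁻ q, ‖q.1 - q.2‖ₑ ∂γ := by
        rw [lintegral_const_mul' _ _ (by simp), lintegral_finsetSum _ fun i _ => by fun_prop]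
        congr 1
        refine Finset.sum_congr rfl fun i _ => ?_
        have hmp : MeasurePreserving (fun p : Fin k → E × E => p i)
          (Measure.pi fun _ : Fin k => γ) γ := measurePreserving_eval _ i
        exact hmp.lintegral_comp (f := fun q : E × E => ‖q.1 - q.2‖ₑ) (by fun_prop)
    _ = _ := by
        simp [mul_assoc]

variable {Ω : ℕ → Type*} [∀ N, MeasurableSpace (Ω N)] {P : ∀ N, Measure (Ω N)}
  [∀ N, IsProbabilityMeasure (P N)] {V : ∀ N, Fin N → Ω N → E} {ν : ProbabilityMeasure E}

/-- For exchangeable families, convergence of the empirical measures implies that finitely many members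
become asymptotically independent. -/
theorem EmpiricalTendsto.tendstoInDistribution (h : EmpiricalTendsto P V ν)
    (hν : HasFiniteFirstMoment ν) (hV : ∀ N i, Measurable (V N i))
    (hex : ∀ N, 0 < N → Exchangeable (V N) (P N)) {k : ℕ} (hk : 1 ≤ k) :
    TendstoInDistribution
      (fun (j : ℕ) (ω : Ω (k + j)) (i : Fin k) => V (k + j) (Fin.castAdd j i) ω) atTop
      id (fun j => P (k + j)) (Measure.pi fun _ : Fin k => (ν : Measure E)) := by
  have hVk : ∀ j, Measurable fun (ω : Ω (k + j)) (i : Fin k) => V (k + j) (Fin.castAdd j i) ω :=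
    fun j => measurable_pi_iff.2 fun i => hV _ _
  refine ⟨fun j => (hVk j).aemeasurable, aemeasurable_id, ?_⟩
  refine tendsto_iff_forall_lipschitz_integral_tendsto.2 ?_
  rintro Φ ⟨C₀, hC₀⟩ ⟨L, hΦ⟩
  have hΦm := hΦ.continuous.measurable
  -- The constant `C₀` bounds only the oscillation of Φ.
  set C : ℝ := |Φ 0| + C₀ with hCdef
  have hC : ∀ y, |Φ y| ≤ C := fun y => by
    have h1 := hC₀ y 0
    rw [Real.dist_eq] at h1
    have h2 := abs_sub_abs_le_abs_sub (Φ y) (Φ 0)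
    linarith
  simp only [ProbabilityMeasure.coe_mk, Measure.map_id]
  simp_rw [integral_map (hVk _).aemeasurable hΦm.aestronglyMeasurable]
  rw [tendsto_iff_edist_tendsto_0]
  simp_rw [edist_eq_enorm_sub]
  choose B hBm hBW hBlim using fun l : ℕ =>
    h.exists_W1_bound hν hV (r := 1 / ((l : ℝ) + 1)) Nat.one_div_pos_of_nat
  have hshift : Tendsto (fun j : ℕ => k + j) atTop atTop :=
    tendsto_atTop_mono (fun j => Nat.le_add_left j k) tendsto_id
  refine ENNReal.tendsto_zero_of_le_double
    (b := fun l j => ENNReal.ofReal (2 * C *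
        (1 - ((k + j).descFactorial k : ℝ) / ((k + j : ℕ) : ℝ) ^ k)) +
      ((L * k : NNReal) : ℝ≥0∞) * ∫⁻ ω, B l (k + j) (fun i => V (k + j) i ω) ∂(P (k + j)))
    (c := fun l => ENNReal.ofReal (2 * C * 0) +
      ((L * k : NNReal) : ℝ≥0∞) * ENNReal.ofReal (1 / ((l : ℝ) + 1)))
    (fun l => Eventually.of_forall fun j => ?_) (fun l => ?_) ?_
  · have hpos : 0 < k + j := by omega
    have : NeZero (k + j) := ⟨hpos.ne'⟩
    have hVj := hV (k + j)
    have hs := (hex (k + j) hpos).abs_integral_sub_average_le (hV _) hΦm hC hpos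
    have hmeas : ∀ σ : Fin k → Fin (k + j), Measurable fun ω => Φ fun i => V (k + j) (σ i) ω :=
      fun σ => hΦm.comp (measurable_pi_iff.2 fun i => hV _ _)
    have hint : ∀ σ : Fin k → Fin (k + j),
        Integrable (fun ω => Φ fun i => V (k + j) (σ i) ω) (P (k + j)) := fun σ =>
      (integrable_const C).mono' (hmeas σ).aestronglyMeasurable (ae_of_all _ fun ω => hC _)
    -- Insert the mean over samples with replacement: the first gap comes from repetitions, the
    -- second from the W₁-distance of the empirical measure to ν.
    rw [← sub_add_sub_cancel _ (∫ ω, (((k + j : ℕ) : ℝ) ^ k)⁻¹ *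
      ∑ σ : Fin k → Fin (k + j), Φ (fun i => V (k + j) (σ i) ω) ∂(P (k + j)))]
    refine (enorm_add_le _ _).trans (add_le_add ?_ ?_)
    · rw [← ofReal_norm]
      exact ENNReal.ofReal_le_ofReal hs
    · have hconst : ∫ y, Φ y ∂(Measure.pi fun _ : Fin k => (ν : Measure E)) =
          ∫ _ω, (∫ y, Φ y ∂(Measure.pi fun _ : Fin k => (ν : Measure E))) ∂(P (k + j)) := by
        simp
      rw [hconst, ← integral_sub ((integrable_finsetSum _ fun σ _ => hint σ).const_mul _)
        (integrable_const _), ← lintegral_const_mul' _ _ ENNReal.coe_ne_top]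
      refine (enorm_integral_le_lintegral_enorm _).trans (lintegral_mono fun ω => ?_)
      rw [← integral_pi_empiricalMeasure (fun i => V (k + j) i ω) hΦm]
      refine (enorm_integral_pi_sub_le _ ν hΦ hC).trans ?_
      gcongr
      exact hBW l (k + j) _
  · refine (ENNReal.tendsto_ofReal ((tendsto_one_sub_descFactorial_div_pow k).const_mul _)).add ?_
    exact ENNReal.Tendsto.const_mul ((hBlim l).comp hshift) (Or.inr ENNReal.coe_ne_top)
  · have h1 := ENNReal.Tendsto.const_mul (a := ((L * k : NNReal) : ℝ≥0∞))
      (ENNReal.tendsto_ofReal (tendsto_one_div_add_atTop_nhds_zero_nat (𝕜 := ℝ)))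
      (Or.inr ENNReal.coe_ne_top)
    simpa using h1

end WeakConvergence

/-! ### The step map of the model. -/

section StepMap

variable {d m : ℕ} (A : Matrix (Fin d) (Fin d) ℝ) (δ : ℝ)
  (f : EuclideanSpace ℝ (Fin d) × ProbabilityMeasure (EuclideanSpace ℝ (Fin d)) ×
    EuclideanSpace ℝ (Fin m) → EuclideanSpace ℝ (Fin d))

/-- One step of the dynamics, with the mean-field argument frozen at `ν`. -/
noncomputable def stepMap (ν : ProbabilityMeasure (EuclideanSpace ℝ (Fin d)))
    (p : EuclideanSpace ℝ (Fin d) × EuclideanSpace ℝ (Fin m)) : EuclideanSpace ℝ (Fin d) :=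
  Matrix.toEuclideanLin A p.1 + δ • f (p.1, ν, p.2)

variable {f}

theorem measurable_stepMap (hf : Measurable f)
    {α : Type*} [MeasurableSpace α] {x : α → EuclideanSpace ℝ (Fin d)}
    {z : α → EuclideanSpace ℝ (Fin m)} {ν : α → ProbabilityMeasure (EuclideanSpace ℝ (Fin d))}
    (hx : Measurable x) (hz : Measurable z) (hν : Measurable ν) :
    Measurable fun a => stepMap A δ f (ν a) (x a, z a) := by
  have hA : Measurable (Matrix.toEuclideanLin A) :=
    (LinearMap.continuous_of_finiteDimensional _).measurable
  unfold stepMap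
  exact (hA.comp hx).add ((hf.comp (hx.prodMk (hν.prodMk hz))).const_smul δ)

theorem measurable_stepMap_left (hf : Measurable f)
    (ν : ProbabilityMeasure (EuclideanSpace ℝ (Fin d))) : Measurable (stepMap A δ f ν) :=
  measurable_stepMap A δ hf measurable_fst measurable_snd measurable_const

/-- One step of the whole interacting particle system. -/
noncomputable def systemStep (f : EuclideanSpace ℝ (Fin d) ×
      ProbabilityMeasure (EuclideanSpace ℝ (Fin d)) ×
      EuclideanSpace ℝ (Fin m) → EuclideanSpace ℝ (Fin d)) {N : ℕ} [NeZero N]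
    (p : (Fin N → EuclideanSpace ℝ (Fin d)) × (Fin N → EuclideanSpace ℝ (Fin m))) (i : Fin N) :
    EuclideanSpace ℝ (Fin d) :=
  stepMap A δ f (empiricalMeasure p.1) (p.1 i, p.2 i)

theorem measurable_systemStep (hf : Measurable f) {N : ℕ} [NeZero N] :
    Measurable (systemStep A δ f (N := N)) := by
  refine measurable_pi_iff.2 fun i => ?_
  have h1 : Measurable fun p : (Fin N → EuclideanSpace ℝ (Fin d)) ×
      (Fin N → EuclideanSpace ℝ (Fin m)) => empiricalMeasure p.1 :=
    measurable_empiricalMeasure.comp measurable_fst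
  exact measurable_stepMap A δ hf ((measurable_pi_apply i).comp measurable_fst)
    ((measurable_pi_apply i).comp measurable_snd) h1

theorem W1_self {E : Type*} [NormedAddCommGroup E] [MeasurableSpace E] [BorelSpace E]
    [SecondCountableTopology E] (μ : ProbabilityMeasure E) : W1 μ μ = 0 := by
  refine le_antisymm ((W1_le_of_coupling ((μ : Measure E).map fun x => (x, x)) ?_ ?_).trans ?_)
    zero_le
  · rw [Measure.map_map measurable_fst (by fun_prop)]
    exact Measure.map_id
  · rw [Measure.map_map measurable_snd (by fun_prop)]
    exact Measure.map_id
  · rw [lintegral_map (by fun_prop) (by fun_prop)]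
    simp

theorem enorm_stepMap_sub_le {z : EuclideanSpace ℝ (Fin m)} (hz : lipCoeff f z ≠ ∞)
    (x x' : EuclideanSpace ℝ (Fin d)) {ν ν' : ProbabilityMeasure (EuclideanSpace ℝ (Fin d))}
    (hν : HasFiniteFirstMoment ν) (hν' : HasFiniteFirstMoment ν') :
    ‖stepMap A δ f ν (x, z) - stepMap A δ f ν' (x', z)‖ₑ ≤
      ‖(Matrix.toEuclideanLin A).toContinuousLinearMap‖ₑ * ‖x - x'‖ₑ +
        ‖δ‖ₑ * (lipCoeff f z * (‖x - x'‖ₑ + W1 ν ν')) := by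
  have hA : stepMap A δ f ν (x, z) - stepMap A δ f ν' (x', z) =
      (Matrix.toEuclideanLin A).toContinuousLinearMap (x - x') +
        δ • (f (x, ν, z) - f (x', ν', z)) := by
    simp only [stepMap, LinearMap.coe_toContinuousLinearMap', map_sub, smul_sub]
    abel
  rw [hA]
  refine (enorm_add_le _ _).trans (add_le_add ?_ ?_)
  · exact ContinuousLinearMap.le_opENorm _ _
  · rw [enorm_smul]
    gcongr
    exact enorm_sub_le_lipCoeff_mul hz x x' hν hν'

/-- The constant is ‖A‖ + |δ| ∫ D dθ. At the origin, compare ν with the Dirac mass at 0, where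
assumption (B) applies. -/
theorem isMeanLipschitz_stepMap (hf : Measurable f)
    {θ : ProbabilityMeasure (EuclideanSpace ℝ (Fin m))} (hA : AssumptionA f θ)
    (hB : AssumptionB f θ) {ν : ProbabilityMeasure (EuclideanSpace ℝ (Fin d))}
    (hν : HasFiniteFirstMoment ν) :
    ∃ L, IsMeanLipschitz (θ : Measure (EuclideanSpace ℝ (Fin m))) (stepMap A δ f ν) L := by
  have hG : Measurable (stepMap A δ f ν) :=
    measurable_stepMap_left A δ hf ν
  have hfin : ∀ᵐ z ∂(θ : Measure (EuclideanSpace ℝ (Fin m))), lipCoeff f z ≠ ∞ :=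
    (ae_lt_top' hA.1 hA.2.ne).mono fun z hz => hz.ne
  set a : ℝ≥0∞ := ‖(Matrix.toEuclideanLin A).toContinuousLinearMap‖ₑ with ha
  set D : ℝ≥0∞ := ∫⁻ z, lipCoeff f z ∂(θ : Measure (EuclideanSpace ℝ (Fin m))) with hD
  have hL : a + ‖δ‖ₑ * D ≠ ∞ := by
    exact ENNReal.add_ne_top.2 ⟨enorm_ne_top, ENNReal.mul_ne_top enorm_ne_top hA.2.ne⟩
  refine ⟨(a + ‖δ‖ₑ * D).toNNReal, hG, ?_, fun x x' => ?_⟩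
  · have hf0 : Measurable fun z => f (0, diracProba 0, z) := hf.comp (by fun_prop)
    calc ∫⁻ z, ‖stepMap A δ f ν (0, z)‖ₑ ∂(θ : Measure (EuclideanSpace ℝ (Fin m)))
        ≤ ∫⁻ z, (‖δ‖ₑ * ‖f (0, diracProba 0, z)‖ₑ +
            ‖δ‖ₑ * (lipCoeff f z * W1 ν (diracProba 0)))
            ∂(θ : Measure (EuclideanSpace ℝ (Fin m))) := by
          refine lintegral_mono_ae ?_
          filter_upwards [hfin] with z hz
          have h1 := enorm_sub_le_lipCoeff_mul hz 0 0 hν (hasFiniteFirstMoment_diracProba 0)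
          simp only [sub_zero, enorm_zero, zero_add] at h1
          simp only [stepMap, map_zero, zero_add, enorm_smul]
          rw [← mul_add]
          gcongr
          calc ‖f (0, ν, z)‖ₑ
              = ‖f (0, diracProba 0, z) + (f (0, ν, z) - f (0, diracProba 0, z))‖ₑ := by
                rw [add_sub_cancel]
            _ ≤ _ := (enorm_add_le _ _).trans (add_le_add le_rfl h1)
      _ = ‖δ‖ₑ * ∫⁻ z, ‖f (0, diracProba 0, z)‖ₑ ∂(θ : Measure (EuclideanSpace ℝ (Fin m))) +
            ‖δ‖ₑ * (D * W1 ν (diracProba 0)) := by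
          rw [lintegral_add_left (by fun_prop), lintegral_const_mul' _ _ (by simp),
            lintegral_const_mul' _ _ (by simp),
            lintegral_mul_const' _ _ (W1_lt_top hν (hasFiniteFirstMoment_diracProba 0)).ne]
      _ < ∞ := by
          refine ENNReal.add_lt_top.2 ⟨ENNReal.mul_lt_top (by simp) hB,
            ENNReal.mul_lt_top (by simp) (ENNReal.mul_lt_top hA.2 ?_)⟩
          exact W1_lt_top hν (hasFiniteFirstMoment_diracProba 0)
  · rw [ENNReal.coe_toNNReal hL]
    calc ∫⁻ z, ‖stepMap A δ f ν (x, z) - stepMap A δ f ν (x', z)‖ₑ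
          ∂(θ : Measure (EuclideanSpace ℝ (Fin m)))
        ≤ ∫⁻ z, (a * ‖x - x'‖ₑ + ‖δ‖ₑ * (lipCoeff f z * ‖x - x'‖ₑ))
          ∂(θ : Measure (EuclideanSpace ℝ (Fin m))) := by
          refine lintegral_mono_ae ?_
          filter_upwards [hfin] with z hz
          simpa [W1_self] using enorm_stepMap_sub_le A δ hz x x' hν hν
      _ = a * ‖x - x'‖ₑ + ‖δ‖ₑ * (D * ‖x - x'‖ₑ) := by
          rw [lintegral_add_left measurable_const, lintegral_const, measure_univ, mul_one,
            lintegral_const_mul' ‖δ‖ₑ _ enorm_ne_top, lintegral_mul_const' _ _ enorm_ne_top]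
      _ = (a + ‖δ‖ₑ * D) * ‖x - x'‖ₑ := by ring

end StepMap

/-! ### Laws of the chain and symmetry of the particle system. -/

section Chain

variable {d m : ℕ} {A : Matrix (Fin d) (Fin d) ℝ} {δ : ℝ}
  {f : EuclideanSpace ℝ (Fin d) × ProbabilityMeasure (EuclideanSpace ℝ (Fin d)) ×
    EuclideanSpace ℝ (Fin m) → EuclideanSpace ℝ (Fin d)}
  {θ : ProbabilityMeasure (EuclideanSpace ℝ (Fin m))}

namespace IsNonlinearChain

variable {μ : ℕ → ProbabilityMeasure (EuclideanSpace ℝ (Fin d))}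
  {Ω : Type*} [MeasurableSpace Ω] {Q : Measure Ω} [IsProbabilityMeasure Q]
  {Y : ℕ → Ω → EuclideanSpace ℝ (Fin d)} {η : ℕ → Ω → EuclideanSpace ℝ (Fin m)}

/-- The state at time n is built from the initial state and earlier noise, hence is independent of
the next noise, while the measure argument is deterministic. -/
theorem law_succ (hY : IsNonlinearChain A δ f θ μ Q Y η) (hf : Measurable f) (n : ℕ) :
    (μ (n + 1) : Measure (EuclideanSpace ℝ (Fin d))) =
      ((μ n : Measure (EuclideanSpace ℝ (Fin d))).prod
        (θ : Measure (EuclideanSpace ℝ (Fin m)))).map (stepMap A δ f (μ n)) := by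
  have hG : ∀ n, Measurable (stepMap A δ f (μ n)) := fun n =>
    measurable_stepMap_left A δ hf (μ n)
  have hfut : ∀ n, IndepFun (η n) (fun ω k => η (n + 1 + k) ω) Q := by
    intro n
    have hdisj : Disjoint ({n} : Set ℕ) {i | n < i} := by simp
    have h := iIndepFun_restrict_disjoint hY.indep_noise hY.measurable_noise hdisj
    have hev : Measurable fun u : ({n} : Set ℕ) → EuclideanSpace ℝ (Fin m) => u ⟨n, rfl⟩ :=
      measurable_pi_apply _
    exact h.comp hev
      (ψ := fun u k => u ⟨n + 1 + k, by simp only [Set.mem_ofPred_eq]; omega⟩)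
      (measurable_pi_iff.2 fun k => measurable_pi_apply _)
  have hind := indepFun_recursion hY.measurable_state hY.measurable_noise hG hY.indep_init_noise
    hfut hY.step n
  have hlaw := hind.map_prod_eq_prod_map_map (hY.measurable_state n).aemeasurable
    (hY.measurable_noise n).aemeasurable
  rw [hY.law_state, hY.law_noise] at hlaw
  rw [← hlaw, Measure.map_map (hG n) ((hY.measurable_state n).prodMk (hY.measurable_noise n)),
    ← hY.law_state]
  exact Measure.map_congr (hY.step n)

theorem hasFiniteFirstMoment (hY : IsNonlinearChain A δ f θ μ Q Y η) (hf : Measurable f)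
    (hA : AssumptionA f θ) (hB : AssumptionB f θ) (h0 : HasFiniteFirstMoment (μ 0)) (n : ℕ) :
    HasFiniteFirstMoment (μ n) := by
  induction n with
  | zero => exact h0
  | succ n ih =>
    obtain ⟨L, hL⟩ := isMeanLipschitz_stepMap A δ hf hA hB ih
    exact hL.hasFiniteFirstMoment_map ih (hY.law_succ hf n)

end IsNonlinearChain

namespace IsParticleSystem

variable {μ₀ : ProbabilityMeasure (EuclideanSpace ℝ (Fin d))} {N : ℕ} [NeZero N]
  {Ω : Type*} [MeasurableSpace Ω] {P : Measure Ω}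
  {X : Fin N → ℕ → Ω → EuclideanSpace ℝ (Fin d)} {ε : Fin N → ℕ → Ω → EuclideanSpace ℝ (Fin m)}

theorem map_noise_perm (hX : IsParticleSystem A δ f θ μ₀ P X ε) (n : ℕ)
    (π : Equiv.Perm (Fin N)) :
    P.map (fun ω i => ε (π i) n ω) =
      Measure.pi fun _ => (θ : Measure (EuclideanSpace ℝ (Fin m))) := by
  have h := hX.indep_noise.precomp (g := fun i : Fin N => (π i, n))
    fun i j hij => π.injective (Prod.ext_iff.1 hij).1
  rw [h.map_fun_eq_pi_map fun i => (hX.measurable_noise _ _).aemeasurable]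
  simp [hX.law_noise]

variable [IsProbabilityMeasure P]

/-- The particles are not independent of each other, so the recursion is run on the configuration of
all N at once. -/
theorem indepFun_state_noise (hX : IsParticleSystem A δ f θ μ₀ P X ε) (hf : Measurable f)
    (n : ℕ) : IndepFun (fun ω i => X i n ω) (fun ω i => ε i n ω) P := by
  have hfut : ∀ n, IndepFun (fun ω i => ε i n ω) (fun ω k i => ε i (n + 1 + k) ω) P := by
    intro n
    have hdisj : Disjoint {p : Fin N × ℕ | p.2 = n} {p | n < p.2} :=
      Set.disjoint_left.2 fun p h1 h2 => by
        simp only [Set.mem_ofPred_eq] at h1 h2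
        omega
    have h := iIndepFun_restrict_disjoint hX.indep_noise
      (fun p => hX.measurable_noise p.1 p.2) hdisj
    exact h.comp (φ := fun u i => u ⟨(i, n), rfl⟩)
      (ψ := fun u k i => u ⟨(i, n + 1 + k), by simp only [Set.mem_ofPred_eq]; omega⟩)
      (measurable_pi_iff.2 fun i => measurable_pi_apply _)
      (measurable_pi_iff.2 fun k => measurable_pi_iff.2 fun i => measurable_pi_apply _)
  refine indepFun_recursion (S := fun n ω i => X i n ω) (U := fun n ω i => ε i n ω)
    (H := fun _ => systemStep A δ f)
    (fun n => measurable_pi_iff.2 fun i => hX.measurable_state i n)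
    (fun n => measurable_pi_iff.2 fun i => hX.measurable_noise i n)
    (fun _ => measurable_systemStep A δ hf) ?_ hfut (fun n => ?_) n
  · exact hX.indep_init_noise.comp (φ := id)
      (ψ := fun u n i => u (i, n)) measurable_id
      (measurable_pi_iff.2 fun k => measurable_pi_iff.2 fun i => measurable_pi_apply _)
  · filter_upwards [ae_all_iff.2 fun i => hX.step i n] with ω hω
    funext i
    exact hω i

theorem map_state_noise_perm (hX : IsParticleSystem A δ f θ μ₀ P X ε) (hf : Measurable f) (n : ℕ)
    (π : Equiv.Perm (Fin N)) :
    P.map (fun ω => ((fun i => X (π i) n ω), fun i => ε (π i) n ω)) =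
      (P.map fun ω i => X (π i) n ω).prod
        (Measure.pi fun _ => (θ : Measure (EuclideanSpace ℝ (Fin m)))) := by
  have h := (hX.indepFun_state_noise hf n).comp (φ := fun x i => x (π i)) (ψ := fun u i => u (π i))
    (by fun_prop) (by fun_prop)
  rw [← hX.map_noise_perm n π]
  exact h.map_prod_eq_prod_map_map
    (measurable_pi_iff.2 fun i => hX.measurable_state _ n).aemeasurable
    (measurable_pi_iff.2 fun i => hX.measurable_noise _ n).aemeasurable

/-- The empirical measure is symmetric, so the system step commutes with relabelling, and relabelled
noise keeps its product law and its independence of the state. -/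
theorem exchangeable (hX : IsParticleSystem A δ f θ μ₀ P X ε) (hf : Measurable f) (n : ℕ) :
    Exchangeable (fun i => X i n) P := by
  induction n with
  | zero => exact hX.exchangeable_init
  | succ n ih =>
    intro π
    have hH := measurable_systemStep A δ hf (N := N)
    have key : ∀ π : Equiv.Perm (Fin N), P.map (fun ω i => X (π i) (n + 1) ω) =
        ((P.map fun ω i => X (π i) n ω).prod
          (Measure.pi fun _ => (θ : Measure (EuclideanSpace ℝ (Fin m))))).map (systemStep A δ f) := by
      intro π
      have hVm : Measurable fun ω i => X (π i) n ω :=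
        measurable_pi_iff.2 fun i => hX.measurable_state _ n
      have hUm : Measurable fun ω i => ε (π i) n ω :=
        measurable_pi_iff.2 fun i => hX.measurable_noise _ n
      rw [← hX.map_state_noise_perm hf n π, Measure.map_map hH (hVm.prodMk hUm)]
      refine Measure.map_congr ?_
      filter_upwards [ae_all_iff.2 fun i => hX.step i n] with ω hω
      funext i
      simp only [Function.comp_apply, systemStep, stepMap]
      rw [empiricalMeasure_comp_perm fun i => X i n ω]
      exact hω (π i)
    have h1 := key 1
    simp only [Equiv.Perm.coe_one, id] at h1
    have h2 := ih π
    simp only at h2 ⊢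
    rw [h1, key π, h2]

end IsParticleSystem

end Chain

/-! ### Induction over time and conclusion. -/

section PropagationOfChaos

variable {d m : ℕ} {A : Matrix (Fin d) (Fin d) ℝ} {δ : ℝ}
  {f : EuclideanSpace ℝ (Fin d) × ProbabilityMeasure (EuclideanSpace ℝ (Fin d)) ×
    EuclideanSpace ℝ (Fin m) → EuclideanSpace ℝ (Fin d)}
  {θ : ProbabilityMeasure (EuclideanSpace ℝ (Fin m))}
  {μ : ℕ → ProbabilityMeasure (EuclideanSpace ℝ (Fin d))}
  {Ω' : Type*} [MeasurableSpace Ω'] {Q : Measure Ω'} [IsProbabilityMeasure Q]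
  {Y : ℕ → Ω' → EuclideanSpace ℝ (Fin d)} {η : ℕ → Ω' → EuclideanSpace ℝ (Fin m)}
  {Ω : ℕ → Type*} [∀ N, MeasurableSpace (Ω N)] {P : ∀ N, Measure (Ω N)}
  [∀ N, IsProbabilityMeasure (P N)]
  {X : ∀ N, Fin N → ℕ → Ω N → EuclideanSpace ℝ (Fin d)}
  {ε : ∀ N, Fin N → ℕ → Ω N → EuclideanSpace ℝ (Fin m)}

/-- The empirical measures of the particle systems converge to the law of the nonlinear chain at every
time. -/
theorem empiricalTendsto_particleSystem (hf : Measurable f) (hA : AssumptionA f θ)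
    (hB : AssumptionB f θ) (hμ₀ : HasFiniteFirstMoment (μ 0))
    (hY : IsNonlinearChain A δ f θ μ Q Y η)
    (hX : ∀ (N : ℕ) [NeZero N], IsParticleSystem A δ f θ (μ 0) (P N) (X N) (ε N))
    (hinit : Tendsto
      (fun N : ℕ => ∫⁻ ω, W1 (empiricalMeasure fun i => X (N + 1) i 0 ω) (μ 0) ∂(P (N + 1)))
      atTop (𝓝 0)) (n : ℕ) :
    EmpiricalTendsto P (fun N i => X N i n) (μ n) := by
  have hne : ∀ {N : ℕ}, Fin N → NeZero N := fun i => ⟨by have := i.pos; omega⟩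
  induction n with
  | zero =>
    intro K φ hφ
    -- The initial hypothesis is indexed by N + 1 particles, which avoids the empty system.
    rw [← tendsto_add_atTop_iff_nat 1]
    have hlim := ENNReal.Tendsto.const_mul (a := (K : ℝ≥0∞)) hinit (Or.inr (by simp))
    rw [mul_zero] at hlim
    refine tendsto_of_tendsto_of_tendsto_of_le_of_le tendsto_const_nhds hlim
      (fun _ => zero_le) fun N => ?_
    simp only
    rw [← lintegral_const_mul' _ _ (by simp)]
    refine lintegral_mono fun ω => ?_
    rw [← integral_empiricalMeasure (fun i => X (N + 1) i 0 ω) hφ.continuous.measurable]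
    exact enorm_integral_sub_le_mul_W1 (hasFiniteFirstMoment_empiricalMeasure _) hμ₀ hφ
  | succ n ih =>
    have hμn := hY.hasFiniteFirstMoment hf hA hB hμ₀ n
    obtain ⟨L, hL⟩ := isMeanLipschitz_stepMap A δ hf hA hB hμn
    have hfin : ∀ᵐ z ∂(θ : Measure (EuclideanSpace ℝ (Fin m))), lipCoeff f z ≠ ∞ :=
      (ae_lt_top' hA.1 hA.2.ne).mono fun z hz => hz.ne
    refine ih.step (U := fun N i => ε N i n) (D := fun z => ‖δ‖ₑ * lipCoeff f z) hμn
      (fun N i => ?_) (fun N i => ?_) (fun N hN => ?_) hL (hY.law_succ hf n)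
      (hA.1.const_mul _) ?_ fun N _ i => ?_
    · have := hne i
      exact (hX N).measurable_state i n
    · have := hne i
      exact (hX N).measurable_noise i n
    · have : NeZero N := ⟨hN.ne'⟩
      simpa using (hX N).map_state_noise_perm hf n 1
    · rw [lintegral_const_mul' _ _ (by simp)]
      exact (ENNReal.mul_lt_top (by simp) hA.2).ne
    · have hz : ∀ᵐ ω ∂(P N), lipCoeff f (ε N i n ω) ≠ ∞ := by
        rw [← (hX N).law_noise i n] at hfin
        exact ae_of_ae_map ((hX N).measurable_noise i n).aemeasurable hfin
      filter_upwards [(hX N).step i n, hz] with ω hω hzω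
      -- Both maps are evaluated at the same point, so only the W₁ term remains.
      have h := enorm_stepMap_sub_le A δ hzω (X N i n ω) (X N i n ω)
        (hasFiniteFirstMoment_empiricalMeasure fun j => X N j n ω) hμn
      rw [hω]
      simpa [stepMap, mul_assoc] using h

end PropagationOfChaos

/-- Propagation of chaos: for the `N`-particle systems with `E W₁(μ^N_0, μ_0) → 0`, the law of the
first `k` of `N = k + j` particles at time `n` converges weakly, as `N → ∞`, to the `k`-fold
product of the law `μ n` of the nonlinear chain at time `n`. -/
theorem corollary3p2 {d m : ℕ} (A : Matrix (Fin d) (Fin d) ℝ) (δ : ℝ)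
    (f : EuclideanSpace ℝ (Fin d) × ProbabilityMeasure (EuclideanSpace ℝ (Fin d)) ×
      EuclideanSpace ℝ (Fin m) → EuclideanSpace ℝ (Fin d))
    (hf : Measurable f)
    (θ : ProbabilityMeasure (EuclideanSpace ℝ (Fin m)))
    (hA : AssumptionA f θ) (hB : AssumptionB f θ)
    -- the nonlinear Markov chain
    {Ω' : Type*} [MeasurableSpace Ω'] (Q : Measure Ω') [IsProbabilityMeasure Q]
    (μ : ℕ → ProbabilityMeasure (EuclideanSpace ℝ (Fin d)))
    (hμ₀ : HasFiniteFirstMoment (μ 0))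
    (Y : ℕ → Ω' → EuclideanSpace ℝ (Fin d)) (η : ℕ → Ω' → EuclideanSpace ℝ (Fin m))
    (hY : IsNonlinearChain A δ f θ μ Q Y η)
    -- the particle systems, one for each number `N ≥ 1` of particles
    {Ω : ℕ → Type*} [∀ N, MeasurableSpace (Ω N)] (P : ∀ N, Measure (Ω N))
    [∀ N, IsProbabilityMeasure (P N)]
    (X : ∀ N, Fin N → ℕ → Ω N → EuclideanSpace ℝ (Fin d))
    (ε : ∀ N, Fin N → ℕ → Ω N → EuclideanSpace ℝ (Fin m))
    (hX : ∀ (N : ℕ) [NeZero N], IsParticleSystem A δ f θ (μ 0) (P N) (X N) (ε N))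
    -- the initial empirical measures converge: `E W₁(μ^N_0, μ_0) → 0`
    (hinit : Tendsto
      (fun N : ℕ => ∫⁻ ω, W1 (empiricalMeasure fun i => X (N + 1) i 0 ω) (μ 0) ∂(P (N + 1)))
      atTop (𝓝 0))
    (k : ℕ) (hk : 1 ≤ k) (n : ℕ) :
    TendstoInDistribution
      (fun (j : ℕ) (ω : Ω (k + j)) (i : Fin k) => X (k + j) (Fin.castAdd j i) n ω) atTop
      id (fun j => P (k + j))
      (Measure.pi fun _ : Fin k => (μ n : Measure (EuclideanSpace ℝ (Fin d)))) :=
  (empiricalTendsto_particleSystem hf hA hB hμ₀ hY hX hinit n).tendstoInDistribution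
    (hY.hasFiniteFirstMoment hf hA hB hμ₀ n)
    (fun N i => have : NeZero N := ⟨i.pos.ne'⟩; (hX N).measurable_state i n)
    (fun N hN => have : NeZero N := ⟨hN.ne'⟩; (hX N).exchangeable hf n) hk
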